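/- **Setting.** Let $p\ge 0$. Currents are continuous linear functionals on smooth compactly supported differential forms, $\partial T(\omega)=T(d\omega)$, $\operatorname{M}$ is mass (with respect to the comass norm), $T\llcorner A$ is the restriction of a current of finite mass to a Borel set $A$, and for $\lambda>0$ $$\mathbb F_\lambda(T)=\inf_S\{\operatorname M(T-\partial S)+\lambda\operatorname M(S)\},$$ the infimum being over all currents $S$ of one dimension more than $T$. For a Lebesgue measurable set $A\subset\mathbb R^{p+1}$ of finite volume and $m:\mathbb R^{p+1}\to\mathbb Z$ (measurable and bounded on $A$), $m\llcorner[[A]]$ is the $(p+1)$-current $\omega\mapsto\int_A m(x)\,\omega(x)(e_1,\dots,e_{p+1})\,dx$, and $[[A]]=1\llcorner[[A]]$. The set $A$ has finite perimeter if $\operatorname M(\partial[[A]])<\infty$. A current is integral if it and its boundary are (integer) rectifiable. Let $E\subset\mathbb R^{p+1}$ be a set of finite perimeter and $U\subset\mathbb R^{p+1}$ a bounded open set with $\operatorname M(\partial(\partial[[E]]\llcorner U))<\infty$. Let $\mathcal E_U$ be the set of all integral $p$-currents of the form $\partial[[F]]\llcorner U$, where $F$ is a set of finite perimeter such that $E\setminus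 U'=F\setminus U'$ for some open $U'$ whose closure is compact and contained in $U$. Let $T_1,\dots,T_N\in\mathcal E_U$. Their envelope $\mathbf{Env}(\{T_i\})$ is the union of the sets $E_{ij}^*$, $i<j$, where $E_{ij}$ is a measurable set of finite volume with $\partial(m\llcorner[[E_{ij}]])=T_i-T_j$ for some measurable integer-valued $m$ with $|m|=1$ on $E_{ij}$ (such a set is unique up to null sets), and $A^*=\{x:\lim_{r\to0}|A\cap B(x,r)|/|B(x,r)|=1\}$. Let $\lambda>0$ be small enough that the flat norm decompositions fill in: for every $T\in\mathcal E_U$ and every $i$, the infimum defining $\mathbb F_\lambda(T-T_i)$ is attained at some $(p+1)$-current $S$ with $\partial S=T-T_i$. A median $\widehat T_\lambda$ is a minimizer of $\sum_{i=1}^N\mathbb F_\lambda(T-T_i)$ over $T\in\mathcal E_U$. **Theorem.** Let $C$ be the closure of $\mathbf{Env}(\{T_i\}_{i=1}^N)$. Every median $\widehat T_\lambda$ satisfies, for all $i$, $$\operatorname{supp}(\widehat T_\lambda-T_i)\subset C\qquad\text{and}\qquad \widehat T_\lambda\llcorner C^c=T_i\llcorner C^c .$$ -/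

import Mathlib

open MeasureTheory Filter Topology TopologicalSpace
open scoped ENNReal Distributions

noncomputable section

namespace FlatMedian

/-! ### Currents -/

/-- The Euclidean space `ℝⁿ`. -/
abbrev Space (n : ℕ) := EuclideanSpace ℝ (Fin n)

/-- `k`-covectors of `ℝⁿ`. The operator norm on this space is the comass norm:
`‖α‖ = sup {|α (v₁, …, vₖ)| : |vᵢ| ≤ 1}`, the supremum being attained at orthonormal tuples. -/
abbrev Covector (n k : ℕ) := Space n [⋀^Fin k]→L[ℝ] ℝ

/-- `k`-vectors of `ℝⁿ`, as the dual of the space of `k`-covectors. -/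
def KVector (n k : ℕ) : Type := Covector n k →L[ℝ] ℝ

instance (n k : ℕ) : NormedAddCommGroup (KVector n k) :=
  inferInstanceAs (NormedAddCommGroup (Covector n k →L[ℝ] ℝ))

instance (n k : ℕ) : NormedSpace ℝ (KVector n k) :=
  inferInstanceAs (NormedSpace ℝ (Covector n k →L[ℝ] ℝ))

/-- The duality pairing `⟨α, ξ⟩ = ξ(α)` of `k`-covectors with `k`-vectors. -/
def pairing (n k : ℕ) : Covector n k →L[ℝ] KVector n k →L[ℝ] ℝ :=
  ContinuousLinearMap.flip
    (show KVector n k →L[ℝ] Covector n k →L[ℝ] ℝ from ContinuousLinearMap.id ℝ (KVector n k))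

theorem pairing_apply {n k : ℕ} (α : Covector n k) (ξ : Covector n k →L[ℝ] ℝ) :
    pairing n k α ξ = ξ α := rfl

/-- Smooth compactly supported `k`-forms on `ℝⁿ`, with the usual locally convex topology. -/
abbrev Form (n k : ℕ) := 𝓓((⊤ : Opens (Space n)), Covector n k)

/-- `k`-currents in `ℝⁿ`: continuous linear functionals on smooth compactly supported
`k`-forms. -/
abbrev Current (n k : ℕ) := Form n k →L[ℝ] ℝ

/-- The exterior derivative on smooth compactly supported forms. -/
def extD (n k : ℕ) : Form n k →L[ℝ] Form n (k + 1) :=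
  (TestFunction.postcompCLM
      (ContinuousAlternatingMap.alternatizeUncurryFinCLM ℝ (Space n) ℝ)).comp
    (TestFunction.fderivCLM ℝ ⊤ ⊤)

/-- The operator above is Mathlib's exterior derivative, pointwise. -/
theorem extD_apply {n k : ℕ} (ω : Form n k) (x : Space n) : extD n k ω x = extDeriv ω x := by
  simp [extD, extDeriv]

/-- The boundary of a `(k+1)`-current, `∂T(ω) = T(dω)`. -/
def boundary {n k : ℕ} (T : Current n (k + 1)) : Current n k := T.comp (extD n k)

/-- The boundary of a current of arbitrary dimension; the boundary of a `0`-current is `0`. -/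
def lowerBoundary {n : ℕ} : {k : ℕ} → Current n k → Current n (k - 1)
  | 0, _ => 0
  | _ + 1, T => boundary T

/-- The mass of a current: the supremum of `T(ω)` over the forms `ω` of comass at most one. -/
def mass {n k : ℕ} (T : Current n k) : ℝ≥0∞ :=
  ⨆ (ω : Form n k) (_ : ∀ x, ‖ω x‖ ≤ 1), ENNReal.ofReal (T ω)

/-- The current `ω ↦ ∫ ⟨ω(x), ξ(x)⟩ dμ(x)` (for a locally `μ`-integrable `k`-vector field `ξ`). -/
def byIntegration {n k : ℕ} (μ : Measure (Space n)) (ξ : Space n → KVector n k) : Current n k :=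
  TestFunction.integralAgainstBilinCLM (pairing n k) μ ξ

open Classical in
/-- The restriction `T ⌞ A` of a current to a Borel set `A`. If `T` is representable by integration,
`T(ω) = ∫ ⟨ω, ξ⟩ dμ` with `ξ` integrable (that is, if `T` has finite mass), then
`(T ⌞ A)(ω) = ∫_A ⟨ω, ξ⟩ dμ`, which does not depend on the choice of `(μ, ξ)`;
the value is `0` for other currents, for which the restriction is not used. -/
def restrict {n k : ℕ} (T : Current n k) (A : Set (Space n)) : Current n k :=
  if h : ∃ r : Measure (Space n) × (Space n → KVector n k),
      Integrable r.2 r.1 ∧ T = byIntegration r.1 r.2 then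
    byIntegration (h.choose.1.restrict A) h.choose.2
  else 0

/-- The support of a current: the complement of the largest open set on which it vanishes. -/
def supp {n k : ℕ} (T : Current n k) : Set (Space n) := Distribution.dsupport T

/-- The standard orienting `n`-vector `e₁ ∧ ⋯ ∧ eₙ` of `ℝⁿ`. -/
def orientation (n : ℕ) : KVector n n :=
  show Covector n n →L[ℝ] ℝ from (ContinuousMultilinearMap.apply ℝ (fun _ : Fin n => Space n) ℝ
      (fun i => EuclideanSpace.single i (1 : ℝ))).comp
    (ContinuousAlternatingMap.toContinuousMultilinearMapCLM ℝ)

/-- The top-dimensional current `ω ↦ ∫ θ(x) ω(x)(e₁, …, eₙ) dx` of a locally integrable density. -/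
def topCurrent {n : ℕ} (θ : Space n → ℝ) : Current n n :=
  byIntegration volume (fun x => θ x • orientation n)

/-- The current `m ⌞ [[A]]`, for a set `A` and an integer multiplicity `m`. -/
def multCurrent {n : ℕ} (m : Space n → ℤ) (A : Set (Space n)) : Current n n :=
  topCurrent (A.indicator fun x => (m x : ℝ))

/-- The current `[[A]]` of a set `A`. -/
def setCurrent {n : ℕ} (A : Set (Space n)) : Current n n := multCurrent (fun _ => 1) A

/-- (Integer) rectifiable `k`-currents: countable sums of Lipschitz images of `ℝᵏ` with
integrable integer multiplicities. The `j`-th piece is the push-forward of `θⱼ ⌞ [[ℝᵏ]]`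
under the Lipschitz map `fⱼ`, that is `ω ↦ ∫ θⱼ(y) ω(fⱼ(y)) (∂₁fⱼ(y), …, ∂ₖfⱼ(y)) dy`, and the total
mass `∑ⱼ ∫ |θⱼ| J fⱼ` of the pieces, with `J f` the `k`-dimensional Jacobian, is finite. -/
def IsRectifiable {n k : ℕ} (T : Current n k) : Prop :=
  ∃ (f : ℕ → Space k → Space n) (θ : ℕ → Space k → ℤ),
    (∀ j, ∃ C, LipschitzWith C (f j)) ∧ (∀ j, Measurable (θ j)) ∧
    (∑' j, ∫⁻ y, ‖(θ j y : ℝ)‖ₑ *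
      ENNReal.ofReal (LinearMap.normDet (fderiv ℝ (f j) y).toLinearMap)) ≠ ∞ ∧
    ∀ ω : Form n k, HasSum
      (fun j => ∫ y, (θ j y : ℝ) *
        ω (f j y) (fun a => fderiv ℝ (f j) y (EuclideanSpace.single a (1 : ℝ)))) (T ω)

/-- Integral currents: the current and its boundary are rectifiable. -/
def IsIntegral {n k : ℕ} (T : Current n k) : Prop :=
  IsRectifiable T ∧ IsRectifiable (lowerBoundary T)

/-- The flat norm at scale `lam`:
the infimum of `M(T - ∂S) + lam * M(S)` over all `(k+1)`-currents `S`. -/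
def flatNorm {n k : ℕ} (lam : ℝ) (T : Current n k) : ℝ≥0∞ :=
  ⨅ S : Current n (k + 1), mass (T - boundary S) + ENNReal.ofReal lam * mass S

/-! ### Sets of finite perimeter, the class `𝓔_U`, the envelope and medians -/

/-- Sets of finite perimeter in `ℝᵖ⁺¹`: Lebesgue measurable sets `A` of finite volume with
`M(∂[[A]]) < ∞`. -/
def IsFinitePerimeter {p : ℕ} (A : Set (Space (p + 1))) : Prop :=
  NullMeasurableSet A volume ∧ volume A < ∞ ∧ mass (boundary (setCurrent A)) < ∞

/-- The class `𝓔_U` determined by a reference set `E` and an open set `U` in `ℝᵖ⁺¹`: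
the integral `p`-currents `∂[[F]] ⌞ U`, where `F` is a set of finite perimeter that coincides
with `E` outside some open set that is compactly contained in `U`. -/
def currentClass {p : ℕ} (E U : Set (Space (p + 1))) : Set (Current (p + 1) p) :=
  {S | IsIntegral S ∧ ∃ F : Set (Space (p + 1)), IsFinitePerimeter F ∧
    S = restrict (boundary (setCurrent F)) U ∧
    ∃ U' : Set (Space (p + 1)), IsOpen U' ∧ IsCompact (closure U') ∧ closure U' ⊆ U ∧
      E \ U' = F \ U'}

/-- The precise representative of a set: the points at which its indicator function has
limiting average `1` over small balls. -/
def preciseRep {n : ℕ} (A : Set (Space n)) : Set (Space n) :=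
  {x | Tendsto (fun r : ℝ => volume (A ∩ Metric.ball x r) / volume (Metric.ball x r))
    (𝓝[>] 0) (𝓝 1)}

/-- The envelope of a family of `p`-currents in `ℝᵖ⁺¹` with shared boundary: the union, over the
pairs `i < j`, of the precise representatives of the regions `A` between `Tᵢ` and `Tⱼ`, that is
`∂(m ⌞ [[A]]) = Tᵢ - Tⱼ` with `|m| = 1` on `A`. -/
def envelope {p N : ℕ} (T : Fin N → Current (p + 1) p) : Set (Space (p + 1)) :=
  {x | ∃ i j : Fin N, i < j ∧ ∃ (A : Set (Space (p + 1))) (m : Space (p + 1) → ℤ),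
    NullMeasurableSet A volume ∧ volume A < ∞ ∧ Measurable m ∧ (∀ y ∈ A, |m y| = 1) ∧
    boundary (multCurrent m A) = T i - T j ∧ x ∈ preciseRep A}

/-- `lam` is small enough that, for every `S` in the class `𝓒` and every `i`, the flat norm of
`S - Tᵢ` is realized by a decomposition that fills in: some `R` with `∂R = S - Tᵢ` attains the
infimum that defines the flat norm. -/
def IsFillingScale {p N : ℕ} (𝓒 : Set (Current (p + 1) p)) (T : Fin N → Current (p + 1) p)
    (lam : ℝ) : Prop :=
  ∀ S ∈ 𝓒, ∀ i, ∃ R : Current (p + 1) (p + 1), boundary R = S - T i ∧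
    flatNorm lam (S - T i) = mass (S - T i - boundary R) + ENNReal.ofReal lam * mass R

/-- `S` is a median of the family `T` in the class `𝓒`: it minimizes the sum of the flat
distances to the `Tᵢ` among the members of `𝓒`. -/
def IsMedian {p N : ℕ} (𝓒 : Set (Current (p + 1) p)) (T : Fin N → Current (p + 1) p)
    (lam : ℝ) (S : Current (p + 1) p) : Prop :=
  S ∈ 𝓒 ∧ ∀ S' ∈ 𝓒, ∑ i, flatNorm lam (S - T i) ≤ ∑ i, flatNorm lam (S' - T i)

end FlatMedian

end

/-! Write the median as `∂[[F]] ⌞ U` and each `Tᵢ` as `∂[[Gᵢ]] ⌞ U`. Since `F` and `Gᵢ` coincide off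
a compact subset of `U`, the difference of the two currents is exactly `∂([[F]] - [[Gᵢ]])`
(`restrict_boundary_sub`). A top-dimensional current of finite mass is determined by its boundary
(`eq_zero_of_boundary_eq_zero`). So at a filling scale the flat distance is `λ` times the mass of
`[[F]] - [[Gᵢ]]`, a fixed positive multiple of the volume of `F ∆ Gᵢ` (`flatNorm_sub`). A median
thus minimizes a sum of volumes of symmetric differences.

Let `B` be the set of points of `F ∆ Gᵢ` at which all the `Gⱼ` agree. If `B` had positive volume,
then near a density point of `B` one could replace `F` by `Gᵢ` inside a small box filled mostly by
`B`. On `B` this removes the point from every `F ∆ Gⱼ` at once, so every summand would decrease,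
contradicting minimality (`measureReal_patch_lt`, `ae_mem_symmDiff`). Hence `F ∆ Gᵢ` is almost
everywhere contained in the union of the `Gⱼ ∆ Gₖ`. By Lebesgue density this union lies, up to a
null set, in the envelope (`ae_mem_envelope`). The median minus `Tᵢ` is then the boundary of a
density that vanishes almost everywhere off `C`, and both conclusions follow.

The substantial point is that the patched set still gives an integral current (`exists_competitor`).
The patch adds to `[[F]]` the current `[[G]] - [[F]]` cut off to a box. By slicing, for almost every
position of a coordinate hyperplane, cutting adds to the boundary only a piece of that hyperplane
with integer multiplicity, which is rectifiable (`slicing`, `HasRectifiableBoundary.indicator_lt`).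
Only boxes with generic faces are needed, so no structure theory of sets of finite perimeter enters.
Slicing and restriction both use that currents of finite mass are representable by integration
(`exists_byIntegration`), which comes from Hahn–Banach and Riesz–Markov–Kakutani. -/

open scoped NNReal

noncomputable section

namespace FlatMedian

section

open scoped BoundedContinuousFunction CompactlySupported

/-! ### Bounded functionals as differences of measures -/

section SignedRiesz

variable {X : Type*} [TopologicalSpace X]

/-- The positive part of a bounded functional, evaluated at a nonnegative function. -/
def posPart (L : (X →ᵇ ℝ) →L[ℝ] ℝ) (g : X →ᵇ ℝ) : ℝ :=
  sSup {t | ∃ h : X →ᵇ ℝ, (∀ x, 0 ≤ h x ∧ h x ≤ g x) ∧ L h = t}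

theorem bddAbove_posPart (L : (X →ᵇ ℝ) →L[ℝ] ℝ) (g : X →ᵇ ℝ) :
    ‖L‖ * ‖g‖ ∈ upperBounds {t | ∃ h : X →ᵇ ℝ, (∀ x, 0 ≤ h x ∧ h x ≤ g x) ∧ L h = t} := by
  rintro t ⟨h, hh, rfl⟩
  refine (le_abs_self _).trans ((L.le_opNorm h).trans ?_)
  gcongr
  refine (BoundedContinuousFunction.norm_le (norm_nonneg _)).2 fun x => ?_
  rw [Real.norm_eq_abs, abs_of_nonneg (hh x).1]
  exact (hh x).2.trans ((le_abs_self _).trans (g.norm_coe_le_norm x))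

theorem le_posPart (L : (X →ᵇ ℝ) →L[ℝ] ℝ) {g h : X →ᵇ ℝ} (hh : ∀ x, 0 ≤ h x ∧ h x ≤ g x) :
    L h ≤ posPart L g :=
  le_csSup ⟨_, bddAbove_posPart L g⟩ ⟨h, hh, rfl⟩

theorem posPart_le (L : (X →ᵇ ℝ) →L[ℝ] ℝ) {g : X →ᵇ ℝ} (hg : ∀ x, 0 ≤ g x) {c : ℝ}
    (hc : ∀ h : X →ᵇ ℝ, (∀ x, 0 ≤ h x ∧ h x ≤ g x) → L h ≤ c) : posPart L g ≤ c := by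
  refine csSup_le ⟨_, 0, fun x => ⟨le_rfl, hg x⟩, rfl⟩ ?_
  rintro t ⟨h, hh, rfl⟩
  exact hc h hh

theorem posPart_nonneg (L : (X →ᵇ ℝ) →L[ℝ] ℝ) {g : X →ᵇ ℝ} (hg : ∀ x, 0 ≤ g x) :
    0 ≤ posPart L g := by
  simpa using le_posPart L (g := g) (h := 0) fun x => ⟨le_rfl, hg x⟩

theorem posPart_le_norm (L : (X →ᵇ ℝ) →L[ℝ] ℝ) {g : X →ᵇ ℝ} (hg : ∀ x, 0 ≤ g x) :
    posPart L g ≤ ‖L‖ * ‖g‖ :=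
  posPart_le L hg fun h hh => bddAbove_posPart L g ⟨h, hh, rfl⟩

theorem posPart_add (L : (X →ᵇ ℝ) →L[ℝ] ℝ) {g₁ g₂ : X →ᵇ ℝ} (h₁ : ∀ x, 0 ≤ g₁ x)
    (h₂ : ∀ x, 0 ≤ g₂ x) : posPart L (g₁ + g₂) = posPart L g₁ + posPart L g₂ := by
  apply le_antisymm
  · refine posPart_le L (fun x => add_nonneg (h₁ x) (h₂ x)) fun h hh => ?_
    -- Riesz decomposition: the first piece lies below `g₁`, and what remains lies below `g₂`.
    have e : h = h ⊓ g₁ + (h - h ⊓ g₁) := by abel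
    rw [e, map_add]
    refine add_le_add (le_posPart L fun x => ⟨le_inf (hh x).1 (h₁ x), inf_le_right⟩)
      (le_posPart L fun x => ?_)
    have := (hh x).2
    simp only [BoundedContinuousFunction.coe_add, Pi.add_apply] at this
    have hm : (h ⊓ g₁) x = min (h x) (g₁ x) := rfl
    simp only [BoundedContinuousFunction.coe_sub, Pi.sub_apply, hm]
    constructor
    · linarith [min_le_left (h x) (g₁ x)]
    · rcases min_cases (h x) (g₁ x) with h' | h' <;> linarith [h₂ x]
  · rw [← le_sub_iff_add_le]
    refine posPart_le L h₁ fun u hu => ?_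
    rw [le_sub_comm]
    refine posPart_le L h₂ fun v hv => ?_
    rw [le_sub_iff_add_le, ← map_add]
    exact le_posPart L fun x => ⟨add_nonneg (hv x).1 (hu x).1, by
      have := add_le_add (hv x).2 (hu x).2
      simp only [BoundedContinuousFunction.coe_add, Pi.add_apply]
      linarith⟩

theorem posPart_smul_le (L : (X →ᵇ ℝ) →L[ℝ] ℝ) {g : X →ᵇ ℝ} (hg : ∀ x, 0 ≤ g x) {c : ℝ}
    (hc : 0 < c) : posPart L (c • g) ≤ c * posPart L g := by
  refine posPart_le L (fun x => mul_nonneg hc.le (hg x)) fun h hh => ?_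
  have e : h = c • (c⁻¹ • h) := by rw [smul_smul, mul_inv_cancel₀ hc.ne', one_smul]
  rw [e, map_smul, smul_eq_mul]
  gcongr
  refine le_posPart L fun x => ?_
  have := hh x
  simp only [BoundedContinuousFunction.coe_smul, smul_eq_mul] at this ⊢
  refine ⟨mul_nonneg (inv_nonneg.2 hc.le) this.1, ?_⟩
  rw [inv_mul_le_iff₀ hc]
  exact this.2

theorem posPart_smul (L : (X →ᵇ ℝ) →L[ℝ] ℝ) {g : X →ᵇ ℝ} (hg : ∀ x, 0 ≤ g x) {c : ℝ}
    (hc : 0 ≤ c) : posPart L (c • g) = c * posPart L g := by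
  rcases hc.eq_or_lt with rfl | hc
  · rw [zero_smul, zero_mul]
    exact le_antisymm ((posPart_le_norm L fun x => le_rfl).trans (by simp))
      (posPart_nonneg L fun x => le_rfl)
  refine le_antisymm (posPart_smul_le L hg hc) ?_
  have := posPart_smul_le L (g := c • g) (fun x => mul_nonneg hc.le (hg x)) (inv_pos.2 hc)
  rw [smul_smul, inv_mul_cancel₀ hc.ne', one_smul] at this
  rwa [← le_inv_mul_iff₀ hc]

/-- The reflection `h ↦ g - h` preserves the order interval `[0, g]`, so the suprema of `L` and of
`-L` over it differ by `L g`. -/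
theorem posPart_sub_posPart_neg (L : (X →ᵇ ℝ) →L[ℝ] ℝ) {g : X →ᵇ ℝ} (hg : ∀ x, 0 ≤ g x) :
    posPart L g - posPart (-L) g = L g := by
  have key : ∀ M : (X →ᵇ ℝ) →L[ℝ] ℝ, posPart M g ≤ M g + posPart (-M) g := fun M => by
    refine posPart_le M hg fun h hh => ?_
    have := le_posPart (-M) (g := g) (h := g - h) fun x => by
      simp only [BoundedContinuousFunction.coe_sub, Pi.sub_apply]
      exact ⟨by linarith [hh x], by linarith [hh x]⟩
    simp only [neg_apply, map_sub] at this
    linarith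
  have h1 := key L
  have h2 := key (-L)
  have e : - -L = L := by ext; simp
  rw [e, neg_apply] at h2
  linarith

/-- A nonnegative compactly supported function as a bounded real function. -/
def toBCF (g : C_c(X, ℝ≥0)) : X →ᵇ ℝ := (g.toReal : C_c(X, ℝ)).toBoundedContinuousFunction

theorem toBCF_apply (g : C_c(X, ℝ≥0)) (x : X) : toBCF g x = g x := by
  simp [toBCF]

/-- The positive part of a bounded functional, as a positive linear functional. -/
def posPartLinear (L : (X →ᵇ ℝ) →L[ℝ] ℝ) : C_c(X, ℝ≥0) →ₗ[ℝ≥0] ℝ≥0 where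
  toFun g := ⟨posPart L (toBCF g), posPart_nonneg L fun x => by simp [toBCF_apply]⟩
  map_add' g h := by
    apply NNReal.eq
    have : toBCF (g + h) = toBCF g + toBCF h := by ext x; simp [toBCF_apply]
    change posPart L (toBCF (g + h)) = posPart L (toBCF g) + posPart L (toBCF h)
    rw [this]
    exact posPart_add L (fun x => by simp [toBCF_apply]) fun x => by simp [toBCF_apply]
  map_smul' c g := by
    apply NNReal.eq
    have : toBCF (c • g) = (c : ℝ) • toBCF g := by ext x; simp [toBCF_apply]
    change posPart L (toBCF (c • g)) = c * posPart L (toBCF g)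
    rw [this]
    exact posPart_smul L (fun x => by simp [toBCF_apply]) c.2

theorem posPartLinear_apply (L : (X →ᵇ ℝ) →L[ℝ] ℝ) (g : C_c(X, ℝ≥0)) :
    (posPartLinear L g : ℝ) = posPart L (toBCF g) := rfl

variable [T2Space X] [LocallyCompactSpace X] [MeasurableSpace X] [BorelSpace X]

/-- By inner regularity it suffices to bound compact sets; a Urysohn function that is `1` on the
compact set shows that the total mass is at most `‖L‖`. -/
theorem isFiniteMeasure_rieszMeasure (L : (X →ᵇ ℝ) →L[ℝ] ℝ) :
    IsFiniteMeasure (NNRealRMK.rieszMeasure (posPartLinear L)) := by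
  refine ⟨lt_of_le_of_lt (b := ENNReal.ofReal ‖L‖) ?_ ENNReal.ofReal_lt_top⟩
  rw [isOpen_univ.measure_eq_iSup_isCompact]
  refine iSup₂_le fun K _ => iSup_le fun hK => ?_
  obtain ⟨f, hf1, -, hf2, hf3⟩ := exists_continuous_one_zero_of_isCompact hK isClosed_empty
    (Set.disjoint_empty K)
  let g : C_c(X, ℝ≥0) := (⟨f, hf2⟩ : C_c(X, ℝ)).nnrealPart
  have hg : ∀ x, (g x : ℝ) = f x := fun x => by
    simp only [g, CompactlySupportedContinuousMap.nnrealPart_apply]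
    exact Real.coe_toNNReal _ (hf3 x).1
  calc NNRealRMK.rieszMeasure (posPartLinear L) K
      = ∫⁻ x in K, 1 ∂NNRealRMK.rieszMeasure (posPartLinear L) := by simp
    _ ≤ ∫⁻ x in K, g x ∂NNRealRMK.rieszMeasure (posPartLinear L) := by
        refine setLIntegral_mono' hK.measurableSet fun x hx => ?_
        have : g x = 1 := NNReal.eq (by rw [hg, hf1 hx]; rfl)
        simp [this]
    _ ≤ ∫⁻ x, g x ∂NNRealRMK.rieszMeasure (posPartLinear L) := setLIntegral_le_lintegral _ _
    _ = posPartLinear L g := NNRealRMK.lintegral_rieszMeasure _ g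
    _ ≤ ENNReal.ofReal ‖L‖ := by
        rw [← ENNReal.ofReal_coe_nnreal]
        refine ENNReal.ofReal_le_ofReal ?_
        rw [posPartLinear_apply]
        refine (posPart_le_norm L fun x => by simp [toBCF_apply]).trans ?_
        refine mul_le_of_le_one_right (norm_nonneg L) ?_
        refine (BoundedContinuousFunction.norm_le zero_le_one).2 fun x => ?_
        rw [toBCF_apply, hg, Real.norm_eq_abs, abs_of_nonneg (hf3 x).1]
        exact (hf3 x).2

/-- Jordan decomposition: the positive parts of `L` and `-L` are each represented by a Riesz
measure. Compact support is required because these measures only represent the functional on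
compactly supported functions. -/
theorem exists_measures_of_boundedFunctional (L : (X →ᵇ ℝ) →L[ℝ] ℝ) :
    ∃ μ ν : Measure X, IsFiniteMeasure μ ∧ IsFiniteMeasure ν ∧
      ∀ g : X →ᵇ ℝ, HasCompactSupport g → L g = ∫ x, g x ∂μ - ∫ x, g x ∂ν := by
  refine ⟨_, _, isFiniteMeasure_rieszMeasure L, isFiniteMeasure_rieszMeasure (-L), fun g hg => ?_⟩
  set μ := NNRealRMK.rieszMeasure (posPartLinear L)
  set ν := NNRealRMK.rieszMeasure (posPartLinear (-L))
  have := isFiniteMeasure_rieszMeasure L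
  have := isFiniteMeasure_rieszMeasure (-L)
  let G : C_c(X, ℝ) := ⟨g.toContinuousMap, hg⟩
  have nn : ∀ h : C_c(X, ℝ≥0), L (toBCF h) = ∫ x, (h x : ℝ) ∂μ - ∫ x, (h x : ℝ) ∂ν := fun h => by
    rw [NNRealRMK.integral_rieszMeasure, NNRealRMK.integral_rieszMeasure, posPartLinear_apply,
      posPartLinear_apply, posPart_sub_posPart_neg L fun x => by simp [toBCF_apply]]
  have e : g = toBCF G.nnrealPart - toBCF (-G).nnrealPart := by
    ext x
    simp only [BoundedContinuousFunction.coe_sub, Pi.sub_apply, toBCF_apply,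
      CompactlySupportedContinuousMap.nnrealPart_apply, Real.coe_toNNReal',
      CompactlySupportedContinuousMap.neg_apply]
    change g x = max (g x) 0 - max (-g x) 0
    rcases le_total 0 (g x) with h | h <;> simp [h]
  have i : ∀ (ρ : Measure X) [IsFiniteMeasure ρ] (h : C_c(X, ℝ≥0)),
      Integrable (fun x => (h x : ℝ)) ρ := fun ρ _ h => by
    have := (toBCF h).integrable ρ
    rwa [show ⇑(toBCF h) = fun x => (h x : ℝ) from funext (toBCF_apply h)] at this
  have e' : ∀ x, g x = (G.nnrealPart x : ℝ) - ((-G).nnrealPart x : ℝ) := fun x => by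
    rw [← toBCF_apply, ← toBCF_apply]
    exact congrArg (fun f : X →ᵇ ℝ => f x) e
  simp only [e']
  rw [integral_sub (i _ _) (i _ _), integral_sub (i _ _) (i _ _), e, map_sub, nn, nn]
  ring

end SignedRiesz

end

section

open scoped BoundedContinuousFunction

/-! ### Forms and currents -/

/-- Finite dimension gives coordinates for forms in `exists_byIntegration` and properness, hence
separability, in `exists_countable_approx`. -/
instance finiteDimensional_covector (n k : ℕ) : FiniteDimensional ℝ (Covector n k) := by
  let f : Covector n k →ₗ[ℝ] MultilinearMap ℝ (fun _ : Fin k => Space n) ℝ :=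
    { toFun := fun α => α.toContinuousMultilinearMap.toMultilinearMap
      map_add' := fun _ _ => rfl
      map_smul' := fun _ _ => rfl }
  refine FiniteDimensional.of_injective f fun α β h => ?_
  ext v
  exact congrArg (fun g : MultilinearMap ℝ (fun _ : Fin k => Space n) ℝ => g v) h

variable {n k : ℕ}

theorem pairing_le (α : Covector n k) (ξ : KVector n k) : ‖pairing n k α ξ‖ ≤ ‖α‖ * ‖ξ‖ := by
  rw [mul_comm]
  exact ContinuousLinearMap.le_opNorm (show Covector n k →L[ℝ] ℝ from ξ) α

theorem byIntegration_apply {μ : Measure (Space n)} {ξ : Space n → KVector n k}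
    (h : Integrable ξ μ) (ω : Form n k) :
    byIntegration μ ξ ω = ∫ x, pairing n k (ω x) (ξ x) ∂μ :=
  TestFunction.integralAgainstBilinCLM_eq_integral (h.locallyIntegrable.locallyIntegrableOn _)

theorem exists_bound (ω : Form n k) : ∃ C, 0 ≤ C ∧ ∀ x, ‖ω x‖ ≤ C := by
  obtain ⟨C, hC⟩ := ω.continuous.bounded_above_of_compact_support ω.hasCompactSupport
  exact ⟨C, (norm_nonneg _).trans (hC 0), hC⟩

theorem integrable_pairing {μ : Measure (Space n)} {ξ : Space n → KVector n k}
    (h : Integrable ξ μ) (ω : Form n k) : Integrable (fun x => pairing n k (ω x) (ξ x)) μ :=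
  TestFunction.integrable_bilin _ (h.locallyIntegrable.locallyIntegrableOn _) ω

theorem mass_lt_top_iff {T : Current n k} :
    mass T < ∞ ↔ ∃ M, 0 ≤ M ∧ ∀ (ω : Form n k) (c : ℝ), (∀ x, ‖ω x‖ ≤ c) → |T ω| ≤ M * c := by
  constructor
  · intro h
    have h1 : ∀ ω : Form n k, (∀ x, ‖ω x‖ ≤ 1) → T ω ≤ (mass T).toReal := fun ω hω => by
      rw [← ENNReal.ofReal_le_iff_le_toReal h.ne]
      exact le_iSup₂ (f := fun (ω : Form n k) (_ : ∀ x, ‖ω x‖ ≤ 1) => ENNReal.ofReal (T ω)) ω hω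
    have h2 : ∀ (ω : Form n k) (c : ℝ), 0 < c → (∀ x, ‖ω x‖ ≤ c) → T ω ≤ (mass T).toReal * c :=
      fun ω c hc hω => by
        have := h1 (c⁻¹ • ω) fun x => by
          rw [smul_apply, norm_smul, Real.norm_eq_abs, abs_of_pos (inv_pos.2 hc),
            inv_mul_le_iff₀ hc]
          simpa using hω x
        rw [map_smul, smul_eq_mul, inv_mul_le_iff₀ hc] at this
        linarith
    refine ⟨(mass T).toReal, ENNReal.toReal_nonneg, fun ω c hω => ?_⟩
    have hc : 0 ≤ c := (norm_nonneg _).trans (hω 0)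
    -- The rescaling needs a positive bound, while `c` may be `0`; the estimate is taken for `d > c`
    -- and passes to the limit.
    have h3 : ∀ (ω : Form n k), (∀ x, ‖ω x‖ ≤ c) → T ω ≤ (mass T).toReal * c := fun ω hω => by
      have : Tendsto (fun d => (mass T).toReal * d) (𝓝[>] c) (𝓝 ((mass T).toReal * c)) :=
        (tendsto_const_nhds.mul tendsto_id).mono_left nhdsWithin_le_nhds
      refine ge_of_tendsto this ?_
      filter_upwards [self_mem_nhdsWithin] with d hd
      exact h2 ω d (hc.trans_lt hd) fun x => (hω x).trans (le_of_lt hd)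
    rw [abs_le']
    refine ⟨h3 ω hω, ?_⟩
    rw [← map_neg]
    exact h3 _ fun x => by rw [neg_apply, norm_neg]; exact hω x
  · rintro ⟨M, hM, h⟩
    refine lt_of_le_of_lt (iSup₂_le fun ω hω => ?_) (ENNReal.ofReal_lt_top (r := M))
    refine ENNReal.ofReal_le_ofReal ((le_abs_self _).trans ?_)
    simpa using h ω 1 hω

theorem mass_sub_lt_top {T T' : Current n k} (h : mass T < ∞) (h' : mass T' < ∞) :
    mass (T - T') < ∞ := by
  rw [mass_lt_top_iff] at *
  obtain ⟨M, hM, h⟩ := h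
  obtain ⟨M', hM', h'⟩ := h'
  refine ⟨M + M', add_nonneg hM hM', fun ω c hω => ?_⟩
  rw [sub_apply, add_mul]
  exact (abs_sub _ _).trans (add_le_add (h ω c hω) (h' ω c hω))

theorem mass_byIntegration_lt_top {μ : Measure (Space n)} {ξ : Space n → KVector n k}
    (h : Integrable ξ μ) : mass (byIntegration μ ξ) < ∞ := by
  refine mass_lt_top_iff.2 ⟨∫ x, ‖ξ x‖ ∂μ, integral_nonneg fun _ => norm_nonneg _, fun ω c hω => ?_⟩
  rw [byIntegration_apply h, ← Real.norm_eq_abs, ← integral_mul_const]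
  refine norm_integral_le_of_norm_le (h.norm.mul_const c) (.of_forall fun x => ?_)
  rw [mul_comm]
  exact (pairing_le _ _).trans (by gcongr; exact hω x)

/-! ### Currents of finite mass are representable by integration -/

/-- The bound says that `L` is continuous for the sup norm on test functions, so Hahn–Banach extends
it to all bounded continuous functions, where the decomposition into measures applies. -/
theorem exists_measures_of_scalar_bound (L : 𝓓((⊤ : Opens (Space n)), ℝ) →ₗ[ℝ] ℝ) {M : ℝ}
    (hM : 0 ≤ M) (hL : ∀ (g : 𝓓((⊤ : Opens (Space n)), ℝ)) (c : ℝ), (∀ x, ‖g x‖ ≤ c) →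
      |L g| ≤ M * c) :
    ∃ μ ν : Measure (Space n), IsFiniteMeasure μ ∧ IsFiniteMeasure ν ∧
      ∀ g : 𝓓((⊤ : Opens (Space n)), ℝ), L g = ∫ x, g x ∂μ - ∫ x, g x ∂ν := by
  let J : 𝓓((⊤ : Opens (Space n)), ℝ) →ₗ[ℝ] (Space n →ᵇ ℝ) :=
    (TestFunction.toBoundedContinuousFunctionCLM ℝ).toLinearMap
  have hJ : Function.Injective J := TestFunction.injective_toBoundedContinuousFunctionCLM ℝ
  have hJx : ∀ g x, J g x = g x := fun g x => rfl
  let e := LinearEquiv.ofInjective J hJ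
  let f₀ : LinearMap.range J →ₗ[ℝ] ℝ := L ∘ₗ e.symm.toLinearMap
  have hf₀ : ∀ y, ‖f₀ y‖ ≤ M * ‖y‖ := fun y => by
    obtain ⟨g, rfl⟩ := e.surjective y
    have : f₀ (e g) = L g := by simp [f₀]
    rw [this]
    exact hL g _ fun x => (J g).norm_coe_le_norm x
  obtain ⟨F, hF, -⟩ := Module.Dual.exists_continuous_extension_of_le_seminorm (LinearMap.range J) f₀
    (p := M.toNNReal • normSeminorm ℝ (Space n →ᵇ ℝ)) (continuous_norm.const_smul M.toNNReal) fun x => by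
      have := hf₀ x
      rwa [← Real.coe_toNNReal M hM] at this
  obtain ⟨μ, ν, hμ, hν, h⟩ := exists_measures_of_boundedFunctional F
  refine ⟨μ, ν, hμ, hν, fun g => ?_⟩
  have h1 := hF (e g)
  have h2 : f₀ (e g) = L g := by simp [f₀]
  have h3 : ((e g : LinearMap.range J) : Space n →ᵇ ℝ) = J g := rfl
  rw [h2, h3, h (J g) g.hasCompactSupport] at h1
  exact h1.symm

theorem exists_density {X : Type*} [MeasurableSpace X] {μ ν : Measure X}
    [IsFiniteMeasure μ] [IsFiniteMeasure ν] (h : μ ≤ ν) :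
    ∃ ρ : X → ℝ, Integrable ρ ν ∧ ∀ g : X → ℝ, ∫ x, g x ∂μ = ∫ x, g x * ρ x ∂ν := by
  have hac : μ ≪ ν := Measure.absolutelyContinuous_of_le h
  refine ⟨fun x => (μ.rnDeriv ν x).toReal, Measure.integrable_toReal_rnDeriv, fun g => ?_⟩
  rw [← integral_rnDeriv_smul hac]
  simp [mul_comm]

/-- In a basis of covectors each coordinate of `T` is a scalar functional with a sup-norm bound,
hence a difference of two finite measures. All of these are dominated by their sum, and their
Radon–Nikodym densities are the components of the vector field. -/
theorem exists_byIntegration {T : Current n k} (hT : mass T < ∞) :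
    ∃ (μ : Measure (Space n)) (ξ : Space n → KVector n k), IsFiniteMeasure μ ∧ Integrable ξ μ ∧
      T = byIntegration μ ξ := by
  obtain ⟨M, hM, h⟩ := mass_lt_top_iff.1 hT
  let b := Module.finBasis ℝ (Covector n k)
  let ι := Fin (Module.finrank ℝ (Covector n k))
  let lift (i : ι) : 𝓓((⊤ : Opens (Space n)), ℝ) →L[ℝ] Form n k :=
    TestFunction.postcompCLM ((ContinuousLinearMap.id ℝ ℝ).smulRight (b i))
  have hlift : ∀ i g x, lift i g x = g x • b i := fun i g x => rfl
  let coord (i : ι) : Form n k →L[ℝ] 𝓓((⊤ : Opens (Space n)), ℝ) :=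
    TestFunction.postcompCLM (LinearMap.toContinuousLinearMap (b.coord i))
  have hcoord : ∀ i ω x, coord i ω x = b.coord i (ω x) := fun i ω x => rfl
  have hsum : ∀ ω : Form n k, ω = ∑ i, lift i (coord i ω) := fun ω => by
    ext1 x
    rw [sum_apply]
    simp only [hlift, hcoord]
    exact (b.sum_repr (ω x)).symm
  have H : ∀ i, ∃ μ ν : Measure (Space n), IsFiniteMeasure μ ∧ IsFiniteMeasure ν ∧
      ∀ g : 𝓓((⊤ : Opens (Space n)), ℝ), T (lift i g) = ∫ x, g x ∂μ - ∫ x, g x ∂ν := fun i =>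
    exists_measures_of_scalar_bound (T.toLinearMap ∘ₗ (lift i).toLinearMap)
      (mul_nonneg hM (norm_nonneg (b i))) fun g c hg => by
        rw [mul_assoc]
        refine h (lift i g) _ fun x => ?_
        rw [hlift, norm_smul, mul_comm]
        gcongr
        exact hg x
  choose μ ν hμ hν hT' using H
  let m : Measure (Space n) := ∑ i, (μ i + ν i)
  have hm : IsFiniteMeasure m := inferInstance
  have hle : ∀ i, μ i + ν i ≤ m := fun i =>
    Finset.single_le_sum (f := fun i => μ i + ν i) (fun _ _ => Measure.zero_le _) (Finset.mem_univ i)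
  choose ρ hρ hρ' using fun i => exists_density ((Measure.le_add_right le_rfl).trans (hle i) : μ i ≤ m)
  choose σ hσ hσ' using fun i => exists_density ((Measure.le_add_left le_rfl).trans (hle i) : ν i ≤ m)
  let c (i : ι) : KVector n k :=
    show Covector n k →L[ℝ] ℝ from LinearMap.toContinuousLinearMap (b.coord i)
  have hc : ∀ i α, pairing n k α (c i) = b.coord i α := fun i α => rfl
  have hξ : Integrable (fun x => ∑ i, (ρ i x - σ i x) • c i) m :=
    integrable_finsetSum _ fun i _ => ((hρ i).sub (hσ i)).smul_const _
  refine ⟨m, fun x => ∑ i, (ρ i x - σ i x) • c i, hm, hξ, ?_⟩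
  ext ω
  rw [byIntegration_apply hξ]
  have bi : ∀ (r : Space n → ℝ) (i : ι), Integrable r m →
      Integrable (fun x => coord i ω x * r x) m := fun r i hr =>
    TestFunction.integrable_bilin (ContinuousLinearMap.mul ℝ ℝ)
      (hr.locallyIntegrable.locallyIntegrableOn _) (coord i ω)
  have e : ∀ x, pairing n k (ω x) (∑ i, (ρ i x - σ i x) • c i) =
      ∑ i, (coord i ω x * ρ i x - coord i ω x * σ i x) := fun x => by
    rw [map_sum]
    refine Finset.sum_congr rfl fun i _ => ?_
    rw [map_smul, hc, hcoord, smul_eq_mul]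
    ring
  simp only [e]
  rw [integral_finsetSum (f := fun i x => coord i ω x * ρ i x - coord i ω x * σ i x) _
    fun i _ => (bi _ i (hρ i)).sub (bi _ i (hσ i))]
  conv_lhs => rw [hsum ω, map_sum]
  refine Finset.sum_congr rfl fun i _ => ?_
  rw [integral_sub (bi _ i (hρ i)) (bi _ i (hσ i)), ← hρ', ← hσ', hT']

end

section

variable {n k : ℕ}

/-! ### Multiplication of forms by smooth functions -/

/-- The product of a smooth function and a test form. -/
def smulForm (η : Space n → ℝ) (hη : ContDiff ℝ ((⊤ : ℕ∞) : WithTop ℕ∞) η) (ω : Form n k) :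
    Form n k :=
  ⟨fun x => η x • ω x, ContDiff.smul hη ω.contDiff,
    HasCompactSupport.mono ω.hasCompactSupport fun x hx h => hx (by simp [h]),
    fun _ _ => trivial⟩

@[simp]
theorem smulForm_apply (η : Space n → ℝ) (hη : ContDiff ℝ ((⊤ : ℕ∞) : WithTop ℕ∞) η)
    (ω : Form n k) (x : Space n) : smulForm η hη ω x = η x • ω x := rfl

theorem extD_eq (ω : Form n k) (x : Space n) :
    extD n k ω x = ContinuousAlternatingMap.alternatizeUncurryFin (fderiv ℝ ω x) := by
  rw [extD_apply]; rfl

/-- Leibniz rule, with `dη ∧ ω` as the second term; in `slicing_single` that term becomes the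
hyperplane slice. -/
theorem extD_smulForm (η : Space n → ℝ) (hη : ContDiff ℝ ((⊤ : ℕ∞) : WithTop ℕ∞) η)
    (ω : Form n k) (x : Space n) :
    extD n k (smulForm η hη ω) x = η x • extD n k ω x +
      ContinuousAlternatingMap.alternatizeUncurryFin ((fderiv ℝ η x).smulRight (ω x)) := by
  rw [extD_eq, extD_eq]
  have h1 : DifferentiableAt ℝ η x := hη.differentiable (by simp) x
  have h2 : DifferentiableAt ℝ ω x := ω.contDiff.differentiable (by simp) x
  have : fderiv ℝ (smulForm η hη ω) x = η x • fderiv ℝ ω x + (fderiv ℝ η x).smulRight (ω x) :=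
    fderiv_fun_smul h1 h2
  rw [this, ContinuousAlternatingMap.alternatizeUncurryFin_add,
    ContinuousAlternatingMap.alternatizeUncurryFin_smul]

theorem tsupport_extD_subset (ω : Form n k) : tsupport (extD n k ω) ⊆ tsupport ω := by
  refine closure_minimal (fun x hx => ?_) (isClosed_tsupport _)
  by_contra h
  refine hx ?_
  have : fderiv ℝ ω x = 0 := by
    by_contra h'
    exact h (tsupport_fderiv_subset ℝ (subset_tsupport _ h'))
  rw [extD_eq, this]
  exact map_zero (ContinuousAlternatingMap.alternatizeUncurryFinCLM ℝ (Space n) ℝ)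

theorem extD_extD (ω : Form n k) : extD n (k + 1) (extD n k ω) = 0 := by
  ext1 x
  rw [extD_apply, show ⇑(extD n k ω) = extDeriv ω from funext (extD_apply ω),
    extDeriv_extDeriv (r := ((⊤ : ℕ∞) : WithTop ℕ∞)) ω.contDiff
      (by rw [minSmoothness_of_isRCLikeNormedField]; exact WithTop.coe_le_coe.2 le_top)]
  rfl

theorem boundary_boundary (T : Current n (k + 2)) : boundary (boundary T) = 0 := by
  ext ω
  change T (extD n (k + 1) (extD n k ω)) = 0
  rw [extD_extD, map_zero]

theorem boundary_apply (T : Current n (k + 1)) (ω : Form n k) : boundary T ω = T (extD n k ω) := rfl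

theorem boundary_sub (T T' : Current n (k + 1)) : boundary (T - T') = boundary T - boundary T' := by
  ext ω; rfl

theorem boundary_add (T T' : Current n (k + 1)) : boundary (T + T') = boundary T + boundary T' := by
  ext ω; rfl

/-! ### Restriction to open sets -/

/-- A sequence of smooth cutoff functions that exhausts the open set `O`. -/
structure IsCutoff (O : Set (Space n)) (χ : ℕ → Space n → ℝ) : Prop where
  contDiff : ∀ j, ContDiff ℝ ((⊤ : ℕ∞) : WithTop ℕ∞) (χ j)
  mem_Icc : ∀ j x, χ j x ∈ Set.Icc (0 : ℝ) 1
  tsupport_subset : ∀ j, tsupport (χ j) ⊆ O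
  eventually_one : ∀ K ⊆ O, IsCompact K → ∀ᶠ j in atTop, ∀ x ∈ K, χ j x = 1

open Manifold in
theorem exists_smooth_zero_one {s t : Set (Space n)} (hs : IsClosed s) (ht : IsClosed t)
    (hd : Disjoint s t) : ∃ f : Space n → ℝ, ContDiff ℝ ((⊤ : ℕ∞) : WithTop ℕ∞) f ∧
      (∀ x ∈ s, f x = 0) ∧ (∀ x ∈ t, f x = 1) ∧ ∀ x, f x ∈ Set.Icc (0 : ℝ) 1 := by
  obtain ⟨f, h0, h1, h2⟩ := exists_contMDiffMap_zero_one_of_isClosed 𝓘(ℝ, Space n) (n := ⊤) hs ht hd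
  exact ⟨f, f.contMDiff.contDiff, h0, h1, h2⟩

theorem exists_isCutoff {O : Set (Space n)} (hO : IsOpen O) : ∃ χ, IsCutoff O χ := by
  -- The extended distance also covers `O = ℝⁿ`, where the complement is empty and the distance is
  -- infinite.
  let d : Space n → ℝ≥0∞ := fun x => Metric.infEDist x Oᶜ
  have hd : Continuous d := Metric.continuous_infEDist
  let a : ℕ → ℝ≥0∞ := fun j => ((j : ℝ≥0∞) + 1)⁻¹
  have ha : ∀ j, a (j + 1) < a j := fun j => by
    simp only [a]
    rw [ENNReal.inv_lt_inv]
    exact ENNReal.add_lt_add_right ENNReal.one_ne_top (by exact_mod_cast Nat.lt_succ_self j)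
  have H : ∀ j, ∃ f : Space n → ℝ, ContDiff ℝ ((⊤ : ℕ∞) : WithTop ℕ∞) f ∧
      (∀ x ∈ {x | d x ≤ a (j + 1)}, f x = 0) ∧ (∀ x ∈ {x | a j ≤ d x}, f x = 1) ∧
      ∀ x, f x ∈ Set.Icc (0 : ℝ) 1 := fun j =>
    exists_smooth_zero_one (isClosed_le hd continuous_const) (isClosed_le continuous_const hd)
      (Set.disjoint_left.2 fun x h1 h2 => absurd (h2.trans h1) (not_le.2 (ha j)))
  choose χ h1 h2 h3 h4 using H
  refine ⟨χ, h1, h4, fun j => ?_, fun K hKO hK => ?_⟩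
  · have : tsupport (χ j) ⊆ {x | a (j + 1) ≤ d x} := by
      refine closure_minimal (fun x hx => ?_) (isClosed_le continuous_const hd)
      by_contra h
      have h' : d x ≤ a (j + 1) := le_of_not_ge h
      exact hx (h2 j x h')
    refine this.trans fun x hx => ?_
    by_contra h
    have h0 : d x = 0 := Metric.infEDist_zero_of_mem h
    have hx' : a (j + 1) ≤ d x := hx
    rw [h0] at hx'
    exact absurd hx' (not_le.2 (by simp only [a]; exact ENNReal.inv_pos.2 (by finiteness)))
  · rcases K.eq_empty_or_nonempty with rfl | hne
    · simp
    obtain ⟨x₀, hx₀, hmin⟩ := hK.exists_isMinOn hne hd.continuousOn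
    have hpos : 0 < d x₀ := by
      rw [pos_iff_ne_zero]
      intro h0
      have : x₀ ∈ closure Oᶜ := Metric.mem_closure_iff_infEDist_zero.2 h0
      rw [hO.isClosed_compl.closure_eq] at this
      exact this (hKO hx₀)
    have ht : Tendsto a atTop (𝓝 0) := by
      have := (tendsto_add_atTop_iff_nat 1).2 ENNReal.tendsto_inv_nat_nhds_zero
      simpa [a] using this
    filter_upwards [ht.eventually (gt_mem_nhds hpos)] with j hj x hx
    exact h3 j x (hj.le.trans (hmin hx))

theorem IsCutoff.tendsto_indicator {O : Set (Space n)} {χ : ℕ → Space n → ℝ} (h : IsCutoff O χ)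
    (x : Space n) : Tendsto (fun j => χ j x) atTop (𝓝 (O.indicator (fun _ => (1 : ℝ)) x)) := by
  by_cases hx : x ∈ O
  · refine tendsto_const_nhds.congr' ?_
    filter_upwards [h.eventually_one {x} (by simpa using hx) isCompact_singleton] with j hj
    rw [hj x rfl, Set.indicator_of_mem hx]
  · have : ∀ j, χ j x = 0 := fun j => by
      by_contra h'
      exact hx (h.tsupport_subset j (subset_tsupport _ h'))
    simp [this, hx]

theorem IsCutoff.abs_le_one {O : Set (Space n)} {χ : ℕ → Space n → ℝ} (h : IsCutoff O χ)
    (j : ℕ) (x : Space n) : |χ j x| ≤ 1 := by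
  rw [abs_of_nonneg (h.mem_Icc j x).1]; exact (h.mem_Icc j x).2

theorem tsupport_smulForm_subset {O : Set (Space n)} {χ : ℕ → Space n → ℝ} (h : IsCutoff O χ)
    (j : ℕ) (ω : Form n k) : tsupport (smulForm (χ j) (h.contDiff j) ω) ⊆ O :=
  (tsupport_smul_subset_left (χ j) ω).trans (h.tsupport_subset j)

theorem tendsto_byIntegration_smulForm {O : Set (Space n)} (hO : IsOpen O) {χ : ℕ → Space n → ℝ}
    (h : IsCutoff O χ) {μ : Measure (Space n)} {ξ : Space n → KVector n k} (hξ : Integrable ξ μ)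
    (ω : Form n k) :
    Tendsto (fun j => byIntegration μ ξ (smulForm (χ j) (h.contDiff j) ω)) atTop
      (𝓝 (byIntegration (μ.restrict O) ξ ω)) := by
  rw [byIntegration_apply hξ.restrict, ← integral_indicator hO.measurableSet]
  simp only [byIntegration_apply hξ]
  refine tendsto_integral_of_dominated_convergence (fun x => ‖pairing n k (ω x) (ξ x)‖)
    (fun j => (integrable_pairing hξ _).aestronglyMeasurable) (integrable_pairing hξ ω).norm
    (fun j => .of_forall fun x => ?_) (.of_forall fun x => ?_)
  · rw [smulForm_apply, map_smul, smul_apply, norm_smul, Real.norm_eq_abs]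
    exact mul_le_of_le_one_left (norm_nonneg _) (h.abs_le_one j x)
  · have := (h.tendsto_indicator x).smul_const (pairing n k (ω x) (ξ x))
    simp only [smulForm_apply, map_smul, smul_apply]
    convert this using 2
    by_cases hx : x ∈ O <;> simp [hx]

/-- The definition of `restrict` picks some representation. For any representation the restriction
is the limit of `T` on forms multiplied by cutoffs, and this limit involves only `T`. -/
theorem restrict_byIntegration {O : Set (Space n)} (hO : IsOpen O) {μ : Measure (Space n)}
    {ξ : Space n → KVector n k} (hξ : Integrable ξ μ) :
    restrict (byIntegration μ ξ) O = byIntegration (μ.restrict O) ξ := by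
  have H : ∃ r : Measure (Space n) × (Space n → KVector n k),
      Integrable r.2 r.1 ∧ byIntegration μ ξ = byIntegration r.1 r.2 := ⟨(μ, ξ), hξ, rfl⟩
  rw [restrict, dif_pos H]
  obtain ⟨χ, hχ⟩ := exists_isCutoff hO
  ext ω
  have h1 := tendsto_byIntegration_smulForm hO hχ H.choose_spec.1 ω
  rw [← H.choose_spec.2] at h1
  exact tendsto_nhds_unique h1 (tendsto_byIntegration_smulForm hO hχ hξ ω)

/-- Describes the restriction to an open set through `T` alone; linearity and locality of the
restriction are read off from this limit. -/
theorem tendsto_restrict {O : Set (Space n)} (hO : IsOpen O) {χ : ℕ → Space n → ℝ}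
    (h : IsCutoff O χ) {T : Current n k} (hT : mass T < ∞) (ω : Form n k) :
    Tendsto (fun j => T (smulForm (χ j) (h.contDiff j) ω)) atTop (𝓝 (restrict T O ω)) := by
  obtain ⟨μ, ξ, -, hξ, rfl⟩ := exists_byIntegration hT
  rw [restrict_byIntegration hO hξ]
  exact tendsto_byIntegration_smulForm hO h hξ ω

theorem mass_restrict_lt_top {O : Set (Space n)} (hO : IsOpen O) {T : Current n k}
    (hT : mass T < ∞) : mass (restrict T O) < ∞ := by
  obtain ⟨μ, ξ, -, hξ, rfl⟩ := exists_byIntegration hT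
  rw [restrict_byIntegration hO hξ]
  exact mass_byIntegration_lt_top hξ.restrict

theorem restrict_sub {O : Set (Space n)} (hO : IsOpen O) {T T' : Current n k} (hT : mass T < ∞)
    (hT' : mass T' < ∞) : restrict (T - T') O = restrict T O - restrict T' O := by
  obtain ⟨χ, hχ⟩ := exists_isCutoff hO
  ext ω
  exact tendsto_nhds_unique (tendsto_restrict hO hχ (mass_sub_lt_top hT hT') ω)
    ((tendsto_restrict hO hχ hT ω).sub (tendsto_restrict hO hχ hT' ω))

/-- Two currents of finite mass that agree on the forms supported in an open set have the same
restriction to it. -/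
theorem restrict_congr {O : Set (Space n)} (hO : IsOpen O) {T T' : Current n k} (hT : mass T < ∞)
    (hT' : mass T' < ∞) (h : ∀ ω : Form n k, tsupport ω ⊆ O → T ω = T' ω) :
    restrict T O = restrict T' O := by
  obtain ⟨χ, hχ⟩ := exists_isCutoff hO
  ext ω
  have h1 := tendsto_restrict hO hχ hT ω
  simp only [h _ (tsupport_smulForm_subset hχ _ ω)] at h1
  exact tendsto_nhds_unique h1 (tendsto_restrict hO hχ hT' ω)

/-- A current of finite mass supported in a compact subset of an open set is equal to its
restriction to the open set. -/
theorem restrict_eq_self {O K : Set (Space n)} (hO : IsOpen O) (hK : IsCompact K) (hKO : K ⊆ O)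
    {T : Current n k} (hT : mass T < ∞) (h : ∀ ω : Form n k, tsupport ω ⊆ Kᶜ → T ω = 0) :
    restrict T O = T := by
  obtain ⟨χ, hχ⟩ := exists_isCutoff hO
  obtain ⟨K', hK', hKK', hK'O⟩ := exists_compact_between hK hO hKO
  ext ω
  refine tendsto_nhds_unique (tendsto_restrict hO hχ hT ω) (tendsto_const_nhds.congr' ?_)
  filter_upwards [hχ.eventually_one K' hK'O hK'] with j hj
  -- For large `j` the difference of the cut-off form and `ω` vanishes on a neighbourhood of `K`, so
  -- `T` kills it.
  rw [← sub_eq_zero, ← map_sub]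
  refine h _ ?_
  refine (closure_minimal (t := (interior K')ᶜ) ?_
    isOpen_interior.isClosed_compl).trans (Set.compl_subset_compl.2 hKK')
  intro x hx hx'
  refine hx ?_
  rw [sub_apply, smulForm_apply, hj x (interior_subset hx'), one_smul, sub_self]

end

section

open scoped symmDiff

variable {n k : ℕ}

/-! ### Top-dimensional forms -/

/-- The standard frame of `ℝⁿ`. -/
def frame (n : ℕ) : Fin n → Space n := fun i => EuclideanSpace.single i (1 : ℝ)

theorem norm_frame (i : Fin n) : ‖frame n i‖ = 1 := by simp [frame]

theorem pairing_orientation (α : Covector n n) : pairing n n α (orientation n) = α (frame n) := rfl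

theorem abs_apply_le_norm (α : Covector n k) {v : Fin k → Space n} (hv : ∀ i, ‖v i‖ = 1) :
    |α v| ≤ ‖α‖ := by
  simpa [hv] using α.le_opNorm v

/-- The volume form of `ℝⁿ`. -/
def volForm (n : ℕ) : Covector n n :=
  { (EuclideanSpace.basisFun (Fin n) ℝ).toBasis.det with
    cont := by
      change Continuous fun v => (EuclideanSpace.basisFun (Fin n) ℝ).toBasis.det v
      simp only [Module.Basis.det_apply]
      refine Continuous.matrix_det (continuous_matrix fun i j => ?_)
      simp only [Module.Basis.toMatrix_apply]
      have : Continuous fun v : Fin n → Space n => (v j) i := by fun_prop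
      simpa using this }

theorem volForm_frame : volForm n (frame n) = 1 := by
  have h : frame n = (EuclideanSpace.basisFun (Fin n) ℝ).toBasis := by
    ext i; simp [frame]
  change (EuclideanSpace.basisFun (Fin n) ℝ).toBasis.det (frame n) = 1
  rw [h, Module.Basis.det_self]

theorem eq_smul_volForm (α : Covector n n) : α = α (frame n) • volForm n := by
  have h : frame n = (EuclideanSpace.basisFun (Fin n) ℝ).toBasis := by
    ext i; simp [frame]
  have := α.toAlternatingMap.eq_smul_basis_det (EuclideanSpace.basisFun (Fin n) ℝ).toBasis
  rw [← h] at this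
  ext v
  exact congrArg (fun f : Space n [⋀^Fin n]→ₗ[ℝ] ℝ => f v) this

theorem norm_volForm_pos : 0 < ‖volForm n‖ := by
  refine norm_pos_iff.2 fun h => ?_
  have := volForm_frame (n := n)
  rw [h] at this
  exact zero_ne_one this

/-- Top covectors form a line. The constant `‖volForm n‖` is `1` by Hadamard's inequality, but only
its positivity matters: it is a common factor of all the masses compared. -/
theorem norm_eq_mul_norm_volForm (α : Covector n n) : ‖α‖ = |α (frame n)| * ‖volForm n‖ := by
  conv_lhs => rw [eq_smul_volForm α]
  rw [norm_smul, Real.norm_eq_abs]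

theorem covector_top_ext {α β : Covector n n} (h : α (frame n) = β (frame n)) : α = β := by
  rw [eq_smul_volForm α, eq_smul_volForm β, h]

/-! ### Top-dimensional currents -/

theorem topCurrent_apply {θ : Space n → ℝ} (hθ : Integrable θ) (ω : Form n n) :
    topCurrent θ ω = ∫ x, θ x * ω x (frame n) := by
  rw [topCurrent, byIntegration_apply (hθ.smul_const _)]
  simp only [map_smul, pairing_orientation, smul_eq_mul]

theorem integrable_mul_form {μ : Measure (Space n)} {θ : Space n → ℝ} (hθ : Integrable θ μ)
    (ω : Form n k) (v : Fin k → Space n) : Integrable (fun x => θ x * ω x v) μ := by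
  let ev : KVector n k := show Covector n k →L[ℝ] ℝ from
    (ContinuousMultilinearMap.apply ℝ (fun _ : Fin k => Space n) ℝ v).comp
      (ContinuousAlternatingMap.toContinuousMultilinearMapCLM ℝ)
  have := integrable_pairing (hθ.smul_const ev) ω
  simp only [map_smul, smul_eq_mul] at this
  exact this

theorem topCurrent_congr_ae {θ θ' : Space n → ℝ} (hθ : Integrable θ) (h : θ =ᵐ[volume] θ') :
    topCurrent θ = topCurrent θ' := by
  ext ω
  rw [topCurrent_apply hθ, topCurrent_apply (hθ.congr h)]
  refine integral_congr_ae ?_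
  filter_upwards [h] with x hx
  rw [hx]

theorem topCurrent_sub {θ θ' : Space n → ℝ} (hθ : Integrable θ) (hθ' : Integrable θ') :
    topCurrent (fun x => θ x - θ' x) = topCurrent θ - topCurrent θ' := by
  ext ω
  have hs : Integrable fun x => θ x - θ' x := hθ.sub hθ'
  rw [sub_apply, topCurrent_apply hs, topCurrent_apply hθ, topCurrent_apply hθ',
    ← integral_sub (integrable_mul_form hθ ω _) (integrable_mul_form hθ' ω _)]
  simp only [sub_mul]

/-! ### The constancy theorem -/

/-- The translate `x ↦ ω (x + h)` of a form. -/
def translate (h : Space n) (ω : Form n k) : Form n k :=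
  ⟨fun x => ω (x + h), ω.contDiff.comp (contDiff_id.add contDiff_const),
    ω.hasCompactSupport.comp_homeomorph (Homeomorph.addRight h), fun _ _ => trivial⟩

theorem translate_apply (h : Space n) (ω : Form n k) (x : Space n) :
    translate h ω x = ω (x + h) := rfl

theorem fderiv_translate (h : Space n) (ω : Form n k) (x : Space n) :
    fderiv ℝ (translate h ω) x = fderiv ℝ ω (x + h) := fderiv_comp_add_right h

/-- The contraction of a form with a constant vector field. -/
def contract (v : Space n) : Form n (k + 1) →L[ℝ] Form n k :=
  TestFunction.postcompCLM ((ContinuousLinearMap.apply ℝ (Covector n k) v).comp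
    (ContinuousAlternatingMap.curryLeftLI (𝕜 := ℝ) (E := Space n) (F := ℝ)
      (n := k)).toContinuousLinearMap)

/-- Cartan's formula for a constant field and a form of top degree, whose own differential vanishes:
`d(ι_e ω)` is the derivative of `ω` along `e`. On the frame, each of the other terms of the
alternating sum has `e` as a repeated argument. -/
theorem extD_contract_frame {p : ℕ} (ω : Form (p + 1) (p + 1)) (x : Space (p + 1)) :
    extD (p + 1) p (contract (frame (p + 1) 0) ω) x = fderiv ℝ ω x (frame (p + 1) 0) := by
  set L := (ContinuousLinearMap.apply ℝ (Covector (p + 1) p) (frame (p + 1) 0)).comp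
    (ContinuousAlternatingMap.curryLeftLI (𝕜 := ℝ) (E := Space (p + 1)) (F := ℝ)
      (n := p)).toContinuousLinearMap with hL
  have hLa : ∀ α w, L α w = α (Matrix.vecCons (frame (p + 1) 0) w) := fun α w => rfl
  refine covector_top_ext ?_
  have h2 : DifferentiableAt ℝ ω x := ω.contDiff.differentiable (by simp) x
  have h3 : fderiv ℝ (contract (frame (p + 1) 0) ω) x = L.comp (fderiv ℝ ω x) :=
    (L.hasFDerivAt.comp x h2.hasFDerivAt).fderiv
  rw [extD_eq, ContinuousAlternatingMap.alternatizeUncurryFin_apply, Fin.sum_univ_succ]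
  simp only [h3, ContinuousLinearMap.comp_apply, hLa]
  rw [Finset.sum_eq_zero, add_zero]
  · simp only [Fin.val_zero, pow_zero, one_smul]
    congr 1
    ext1 i
    refine Fin.cases rfl (fun j => rfl) i
  · intro j _
    let i₁ : Fin p := ⟨0, j.pos⟩
    have h4 : j.succ.succAbove i₁ = 0 := by
      simp [i₁, Fin.succAbove, Fin.lt_def]
    rw [(fderiv ℝ ω x (frame (p + 1) j.succ)).map_eq_zero_of_eq _ (i := 0) (j := i₁.succ) _
      (Fin.succ_ne_zero i₁).symm, smul_zero]
    simp only [Matrix.cons_val_zero, Matrix.cons_val_succ, Fin.removeNth_apply, h4]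

/-- Translate the test form along `t e`. The derivative in `t` of the value of `D` is `∂D` on a
contracted form, hence zero, so the value is constant. As `t → ∞` the form leaves every point, and
dominated convergence against a finite measure makes the constant `0`. -/
theorem eq_zero_of_boundary_eq_zero {p : ℕ} {D : Current (p + 1) (p + 1)} (hD : mass D < ∞)
    (h : boundary D = 0) : D = 0 := by
  obtain ⟨μ, ξ, hμ, hξ, hDξ⟩ := exists_byIntegration hD
  ext ω
  set e := frame (p + 1) 0
  let Φ : ℝ → ℝ := fun t => ∫ x, pairing _ _ (ω (x + t • e)) (ξ x) ∂μ
  have hΦ : ∀ t, Φ t = D (translate (t • e) ω) := fun t => by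
    rw [hDξ, byIntegration_apply hξ]; rfl
  have hdiff : Differentiable ℝ ω := ω.contDiff.differentiable (by simp)
  obtain ⟨C, hC⟩ : ∃ C, ∀ x, ‖fderiv ℝ ω x‖ ≤ C :=
    (ω.contDiff.continuous_fderiv (by simp)).bounded_above_of_compact_support
      (ω.hasCompactSupport.fderiv ℝ)
  have hderiv : ∀ t, HasDerivAt Φ 0 t := fun t => by
    have h0 : (∫ x, pairing _ _ (fderiv ℝ ω (x + t • e) e) (ξ x) ∂μ) = 0 := by
      have h1 : boundary D (contract e (translate (t • e) ω)) = 0 := by rw [h]; rfl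
      rw [boundary_apply, hDξ, byIntegration_apply hξ] at h1
      rw [← h1]
      congr 1 with x
      rw [extD_contract_frame, fderiv_translate]
    rw [← h0]
    refine (hasDerivAt_integral_of_dominated_loc_of_deriv_le (𝕜 := ℝ) (μ := μ) (x₀ := t)
      (F := fun t x => pairing (p + 1) (p + 1) (ω (x + t • e)) (ξ x))
      (F' := fun t x => pairing (p + 1) (p + 1) (fderiv ℝ ω (x + t • e) e) (ξ x)) (bound := fun x => C * ‖e‖ * ‖ξ x‖) univ_mem ?_ ?_ ?_ ?_ ?_ ?_).2
    · exact .of_forall fun t => (integrable_pairing hξ (translate (t • e) ω)).aestronglyMeasurable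
    · exact integrable_pairing hξ (translate (t • e) ω)
    · have := (integrable_pairing hξ (extD _ _ (contract e (translate (t • e) ω)))).aestronglyMeasurable
      refine this.congr (.of_forall fun x => ?_)
      simp only
      rw [extD_contract_frame, fderiv_translate]
    · refine .of_forall fun x t _ => (pairing_le _ _).trans ?_
      gcongr
      exact (ContinuousLinearMap.le_opNorm _ _).trans (by gcongr; exact hC _)
    · exact hξ.norm.const_mul _
    · refine .of_forall fun x t _ => ?_
      have h1 : HasDerivAt (fun t : ℝ => x + t • e) e t := by
        simpa using ((hasDerivAt_id t).smul_const e).const_add x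
      have h2 := (hdiff (x + t • e)).hasFDerivAt.comp_hasDerivAt t h1
      exact (((pairing _ _).flip (ξ x)).hasFDerivAt.comp_hasDerivAt t h2)
  have hconst : ∀ t, Φ t = Φ 0 := fun t =>
    is_const_of_deriv_eq_zero (fun t => (hderiv t).differentiableAt) (fun t => (hderiv t).deriv) t 0
  have hlim : Tendsto Φ atTop (𝓝 (∫ x, (0 : ℝ) ∂μ)) := by
    obtain ⟨B, hB0, hB⟩ := exists_bound ω
    refine tendsto_integral_filter_of_dominated_convergence (fun x => B * ‖ξ x‖)
      (.of_forall fun t => (integrable_pairing hξ (translate (t • e) ω)).aestronglyMeasurable)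
      (.of_forall fun t => .of_forall fun x => (pairing_le _ _).trans (by gcongr; exact hB _))
      (hξ.norm.const_mul _) (.of_forall fun x => ?_)
    obtain ⟨R, hR⟩ := ω.hasCompactSupport.isCompact.isBounded.subset_closedBall 0
    refine tendsto_const_nhds.congr' ?_
    filter_upwards [eventually_gt_atTop (R + ‖x‖), eventually_ge_atTop 0] with t ht ht0
    have : ω (x + t • e) = 0 := by
      by_contra h'
      have := hR (subset_tsupport _ h')
      rw [mem_closedBall_zero_iff] at this
      have h2 : ‖t • e‖ ≤ ‖x + t • e‖ + ‖x‖ := by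
        simpa using norm_sub_le (x + t • e) x
      rw [norm_smul, norm_frame, Real.norm_eq_abs, abs_of_nonneg ht0] at h2
      linarith
    rw [this, map_zero]; rfl
  rw [integral_zero] at hlim
  have h1 : Tendsto Φ atTop (𝓝 (Φ 0)) := tendsto_const_nhds.congr fun t => (hconst t).symm
  have h2 := tendsto_nhds_unique h1 hlim
  rw [hΦ] at h2
  have h3 : translate ((0 : ℝ) • e) ω = ω := by
    ext1 x
    rw [translate_apply, zero_smul, add_zero]
  rwa [h3] at h2

end

section

open scoped symmDiff

variable {n k : ℕ}

/-! ### Masses of top-dimensional currents of sets -/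

/-- The form `g • vol`. -/
def scalarForm (g : Space n → ℝ) (hg : ContDiff ℝ ((⊤ : ℕ∞) : WithTop ℕ∞) g)
    (hs : HasCompactSupport g) : Form n n :=
  ⟨fun x => g x • volForm n, ContDiff.smul hg contDiff_const,
    HasCompactSupport.mono hs fun x hx h => hx (by simp [h]), fun _ _ => trivial⟩

theorem topCurrent_indicator_sub_apply {F G : Set (Space n)} (hF : MeasurableSet F)
    (hG : MeasurableSet G) (hF' : volume F < ∞) (hG' : volume G < ∞) (ω : Form n n) :
    topCurrent (fun x => F.indicator 1 x - G.indicator (1 : Space n → ℝ) x) ω =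
      (∫ x in F \ G, ω x (frame n)) - ∫ x in G \ F, ω x (frame n) := by
  have i : ∀ A : Set (Space n), MeasurableSet A → volume A < ∞ →
      Integrable (A.indicator (1 : Space n → ℝ)) := fun A hA hA' =>
    (integrable_indicator_iff hA).2 (integrableOn_const hA'.ne)
  have e : ∀ A : Set (Space n), MeasurableSet A → volume A < ∞ →
      ∫ x in A, ω x (frame n) = ∫ x, A.indicator (1 : Space n → ℝ) x * ω x (frame n) :=
    fun A hA hA' => by
      rw [← integral_indicator hA]
      congr 1 with x
      by_cases hx : x ∈ A <;> simp [hx]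
  have h1 : volume (F \ G) < ∞ := (measure_mono Set.sdiff_subset).trans_lt hF'
  have h2 : volume (G \ F) < ∞ := (measure_mono Set.sdiff_subset).trans_lt hG'
  have hs : Integrable fun x => F.indicator 1 x - G.indicator (1 : Space n → ℝ) x :=
    (i F hF hF').sub (i G hG hG')
  rw [topCurrent_apply hs, e _ (hF.diff hG) h1, e _ (hG.diff hF) h2,
    ← integral_sub (integrable_mul_form (i _ (hF.diff hG) h1) ω _)
      (integrable_mul_form (i _ (hG.diff hF) h2) ω _)]
  congr 1 with x
  by_cases hx : x ∈ F <;> by_cases hy : x ∈ G <;> simp [hx, hy]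

theorem integrableOn_form {A : Set (Space n)} (hA' : volume A < ∞) (ω : Form n k)
    (v : Fin k → Space n) : IntegrableOn (fun x => ω x v) A := by
  have h : Integrable (fun _ : Space n => (1 : ℝ)) (volume.restrict A) := integrableOn_const hA'.ne
  have := integrable_mul_form h ω v
  simp only [one_mul] at this
  exact this

/-- The part on `K` contributes its volume and the rest loses at most its volume: `|K| - |P \ K| =
2|K| - |P|`. -/
theorem setIntegral_ge_of_eq_one {P K : Set (Space n)} (hP : MeasurableSet P) (hK : MeasurableSet K)
    (hKP : K ⊆ P) (hP' : volume P < ∞) {g : Space n → ℝ} (hg : IntegrableOn g P)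
    (h1 : ∀ x ∈ K, g x = 1) (h2 : ∀ x, -1 ≤ g x) :
    2 * volume.real K - volume.real P ≤ ∫ x in P, g x := by
  have hd : volume.real (P \ K) = volume.real P - volume.real K :=
    measureReal_sdiff hKP hK hP'.ne
  have e : ∫ x in P, g x = (∫ x in K, g x) + ∫ x in P \ K, g x := by
    rw [← setIntegral_union Set.disjoint_sdiff_right (hP.diff hK) (hg.mono_set hKP)
      (hg.mono_set Set.sdiff_subset), Set.union_sdiff_cancel hKP]
  have e1 : ∫ x in K, g x = volume.real K := by
    rw [setIntegral_congr_fun hK h1]; simp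
  have e2 : -volume.real (P \ K) ≤ ∫ x in P \ K, g x := by
    have : ∫ x in P \ K, (-1 : ℝ) = -volume.real (P \ K) := by simp
    rw [← this]
    refine setIntegral_mono (integrableOn_const ?_) (hg.mono_set Set.sdiff_subset) h2
    exact (hP'.trans_le' (measure_mono Set.sdiff_subset)).ne
  linarith

/-- The upper bound is pointwise. For the lower bound, test with a form of comass at most one that
attains the values `±‖volForm n‖⁻¹` on compact sets nearly filling `F \ G` and `G \ F`. -/
theorem mass_topCurrent_indicator_sub {F G : Set (Space n)} (hF : MeasurableSet F)
    (hG : MeasurableSet G) (hF' : volume F < ∞) (hG' : volume G < ∞) :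
    mass (topCurrent (fun x => F.indicator 1 x - G.indicator (1 : Space n → ℝ) x)) =
      ENNReal.ofReal (‖volForm n‖⁻¹ * volume.real (F ∆ G)) := by
  have hP := hF.diff hG
  have hN := hG.diff hF
  have hP' : volume (F \ G) < ∞ := (measure_mono Set.sdiff_subset).trans_lt hF'
  have hN' : volume (G \ F) < ∞ := (measure_mono Set.sdiff_subset).trans_lt hG'
  have hPN : Disjoint (F \ G) (G \ F) := Set.disjoint_left.2 fun x hx hy => hx.2 hy.1
  have hc : 0 < ‖volForm n‖ := norm_volForm_pos
  have hΔ : volume.real (F ∆ G) = volume.real (F \ G) + volume.real (G \ F) :=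
    measureReal_union hPN hN hP'.ne hN'.ne
  apply le_antisymm
  · refine iSup₂_le fun ω hω => ENNReal.ofReal_le_ofReal ?_
    rw [topCurrent_indicator_sub_apply hF hG hF' hG', hΔ, mul_add]
    have hb : ∀ x, ‖ω x (frame n)‖ ≤ ‖volForm n‖⁻¹ := fun x => by
      have := hω x
      rw [norm_eq_mul_norm_volForm] at this
      rwa [Real.norm_eq_abs, inv_eq_one_div, le_div_iff₀ hc]
    have h1 := norm_setIntegral_le_of_norm_le_const hP' fun x _ => hb x
    have h2 := norm_setIntegral_le_of_norm_le_const hN' fun x _ => hb x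
    rw [Real.norm_eq_abs] at h1 h2
    linarith [le_abs_self (∫ x in F \ G, ω x (frame n)), neg_abs_le (∫ x in G \ F, ω x (frame n))]
  · refine ENNReal.le_of_forall_pos_le_add fun ε hε _ => ?_
    have hε' : (0 : ℝ) < ε := hε
    -- Each of the two compact sets loses at most `2δ` in the integral, so the total loss is
    -- `‖volForm n‖⁻¹ * 4δ = ε`.
    set δ : ℝ := ε * ‖volForm n‖ / 4 with hδ
    have hδ0 : 0 < δ := by positivity
    have happrox : ∀ P : Set (Space n), MeasurableSet P → volume P < ∞ →
        ∃ K ⊆ P, IsCompact K ∧ volume.real P ≤ volume.real K + δ := fun P hP hP' => by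
      obtain ⟨K, hKP, hK, h⟩ := hP.exists_isCompact_lt_add hP'.ne
        (ε := ENNReal.ofReal δ) (by simpa using hδ0)
      refine ⟨K, hKP, hK, ?_⟩
      have hKf : volume K ≠ ∞ := hK.measure_lt_top.ne
      have := ENNReal.toReal_mono (ENNReal.add_ne_top.2 ⟨hKf, ENNReal.ofReal_ne_top⟩) h.le
      rwa [ENNReal.toReal_add hKf ENNReal.ofReal_ne_top,
        ENNReal.toReal_ofReal hδ0.le] at this
    obtain ⟨K, hKP, hK, hKv⟩ := happrox _ hP hP'
    obtain ⟨L, hLN, hL, hLv⟩ := happrox _ hN hN'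
    have hKL : Disjoint K L := hPN.mono hKP hLN
    obtain ⟨R, hR⟩ := (hK.union hL).isBounded.subset_ball 0
    obtain ⟨f, hf, hf0, hf1, hfI⟩ := exists_smooth_zero_one (s := L ∪ (Metric.ball 0 R)ᶜ) (t := K)
      (hL.isClosed.union Metric.isOpen_ball.isClosed_compl) hK.isClosed
      (Set.disjoint_left.2 fun x hx hxK => hx.elim (fun h => Set.disjoint_left.1 hKL hxK h)
        fun h => h (hR (Or.inl hxK)))
    obtain ⟨f', hf', hf0', hf1', hfI'⟩ := exists_smooth_zero_one (s := K ∪ (Metric.ball 0 R)ᶜ)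
      (t := L) (hK.isClosed.union Metric.isOpen_ball.isClosed_compl) hL.isClosed
      (Set.disjoint_left.2 fun x hx hxL => hx.elim (fun h => Set.disjoint_left.1 hKL h hxL)
        fun h => h (hR (Or.inr hxL)))
    let g : Space n → ℝ := fun x => ‖volForm n‖⁻¹ * (f x - f' x)
    have hg : ContDiff ℝ ((⊤ : ℕ∞) : WithTop ℕ∞) g := contDiff_const.mul (hf.sub hf')
    have hgs : HasCompactSupport g := by
      refine HasCompactSupport.intro (isCompact_closedBall (0 : Space n) R) fun x hx => ?_
      have hx' : x ∈ (Metric.ball (0 : Space n) R)ᶜ := fun h => hx (Metric.ball_subset_closedBall h)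
      simp only [g, hf0 x (Or.inr hx'), hf0' x (Or.inr hx'), sub_self, mul_zero]
    have hω : ∀ x, ‖scalarForm g hg hgs x‖ ≤ 1 := fun x => by
      change ‖g x • volForm n‖ ≤ 1
      rw [norm_smul, Real.norm_eq_abs, abs_mul, abs_of_pos (inv_pos.2 hc), mul_comm, ← mul_assoc,
        mul_inv_cancel₀ hc.ne', one_mul, abs_le]
      constructor <;> linarith [(hfI x).1, (hfI x).2, (hfI' x).1, (hfI' x).2]
    refine le_trans ?_ (add_le_add_left (le_iSup₂ (f := fun (ω : Form n n)
      (_ : ∀ x, ‖ω x‖ ≤ 1) => ENNReal.ofReal (topCurrent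
        (fun x => F.indicator 1 x - G.indicator (1 : Space n → ℝ) x) ω)) (scalarForm g hg hgs) hω) _)
    rw [topCurrent_indicator_sub_apply hF hG hF' hG']
    have hge : ∀ x, scalarForm g hg hgs x (frame n) = ‖volForm n‖⁻¹ * (f x - f' x) := fun x => by
      change (g x • volForm n) (frame n) = _
      rw [ContinuousAlternatingMap.smul_apply, volForm_frame, smul_eq_mul, mul_one]
    have hi : ∀ A : Set (Space n), volume A < ∞ → IntegrableOn (fun x => f x - f' x) A :=
      fun A hA => by
        have := (integrableOn_form hA (scalarForm g hg hgs) (frame n)).const_mul ‖volForm n‖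
        simp only [hge, ← mul_assoc, mul_inv_cancel₀ hc.ne', one_mul] at this
        exact this
    simp only [hge, integral_const_mul]
    rw [← mul_sub]
    have h1 := setIntegral_ge_of_eq_one hP hK.measurableSet hKP hP' (hi _ hP')
      (fun x hx => by rw [hf1 x hx, hf0' x (Or.inl hx), sub_zero])
      (fun x => by linarith [(hfI x).1, (hfI' x).2])
    have h2 := setIntegral_ge_of_eq_one hN hL.measurableSet hLN hN' (hi _ hN').neg
      (fun x hx => by simp [hf1' x hx, hf0 x (Or.inl hx)])
      (fun x => by simp only [Pi.neg_apply]; linarith [(hfI x).2, (hfI' x).1])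
    simp only [Pi.neg_apply, integral_neg] at h2
    rw [← ENNReal.ofReal_coe_nnreal]
    refine (ENNReal.ofReal_le_ofReal ?_).trans ENNReal.ofReal_add_le
    have hεc : (ε : ℝ) = ‖volForm n‖⁻¹ * (4 * δ) := by
      rw [hδ]; field_simp
    rw [hεc, ← mul_add]
    refine mul_le_mul_of_nonneg_left ?_ (inv_nonneg.2 hc.le)
    rw [hΔ]
    linarith

end

section

variable {n k : ℕ}

/-! ### Rectifiable currents -/

/-- If `L` is injective, expand in an orthonormal basis of its range: the determinant is the
Jacobian, and the covector on that basis is bounded by its norm. Otherwise the arguments are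
dependent and both sides vanish. This lets the Jacobian mass control every push-forward integral. -/
theorem abs_apply_le_norm_mul_normDet (α : Covector n k) (L : Space k →L[ℝ] Space n) :
    |α fun a => L (frame k a)| ≤ ‖α‖ * LinearMap.normDet L.toLinearMap := by
  let bu := EuclideanSpace.basisFun (Fin k) ℝ
  have hbu : ∀ a, bu a = frame k a := fun a => by simp [bu, frame]
  by_cases hL : L.toLinearMap.ker = ⊥
  · obtain ⟨bv⟩ : Nonempty (OrthonormalBasis (Fin k) ℝ L.toLinearMap.range) := by
      have : Module.finrank ℝ L.toLinearMap.range = k := by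
        rw [LinearMap.finrank_range_of_inj (LinearMap.ker_eq_bot.1 hL)]; simp
      exact ⟨(stdOrthonormalBasis ℝ L.toLinearMap.range).reindex (finCongr this)⟩
    rw [L.toLinearMap.normDet_eq_norm_det_toMatrix_rangeRestrict bu bv]
    let β : L.toLinearMap.range [⋀^Fin k]→ₗ[ℝ] ℝ :=
      α.toAlternatingMap.compLinearMap L.toLinearMap.range.subtype
    have h1 : (α fun a => L (frame k a)) = β fun a => L.toLinearMap.rangeRestrict (bu a) := by
      simp only [hbu]; rfl
    have h2 : |β bv.toBasis| ≤ ‖α‖ := by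
      change |α fun a => ((bv.toBasis a : L.toLinearMap.range) : Space n)| ≤ ‖α‖
      refine abs_apply_le_norm α fun i => ?_
      rw [OrthonormalBasis.coe_toBasis]
      exact bv.norm_eq_one i
    have h3 : (LinearMap.toMatrix bu.toBasis bv.toBasis L.toLinearMap.rangeRestrict) =
        bv.toBasis.toMatrix fun a => L.toLinearMap.rangeRestrict (bu a) := by
      ext i j
      simp [LinearMap.toMatrix_apply, Module.Basis.toMatrix_apply]
    rw [h1, β.eq_smul_basis_det bv.toBasis, h3]
    simp only [AlternatingMap.smul_apply, Module.Basis.det_apply, smul_eq_mul, abs_mul,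
      Real.norm_eq_abs]
    gcongr
  · rw [LinearMap.normDet_eq_zero_iff_ker_ne_bot.2 hL, mul_zero]
    have h : ¬ LinearIndependent ℝ fun a => L (frame k a) := fun h => hL <| by
      have h' : LinearIndependent ℝ (L.toLinearMap ∘ bu.toBasis) := by
        convert h using 2 with a
        simp [hbu]
      exact LinearMap.ker_eq_bot.2
        (LinearMap.injective_of_linearIndependent bu.toBasis.span_eq h')
    have : (α fun a => L (frame k a)) = 0 := α.toAlternatingMap.map_linearDependent _ h
    rw [this, abs_zero]

/-- The integrand of the push-forward of `θ ⌞ [[ℝᵏ]]` under `f`. -/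
def pushIntegrand (f : Space k → Space n) (θ : Space k → ℤ) (ω : Form n k) (y : Space k) : ℝ :=
  (θ y : ℝ) * ω (f y) (fun a => fderiv ℝ f y (EuclideanSpace.single a (1 : ℝ)))

/-- The total mass `∫ |θ| J f` of the push-forward of `θ ⌞ [[ℝᵏ]]` under `f`. -/
def pushMass (f : Space k → Space n) (θ : Space k → ℤ) : ℝ≥0∞ :=
  ∫⁻ y, ‖(θ y : ℝ)‖ₑ * ENNReal.ofReal (LinearMap.normDet (fderiv ℝ f y).toLinearMap)

theorem isRectifiable_iff {T : Current n k} : IsRectifiable T ↔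
    ∃ (f : ℕ → Space k → Space n) (θ : ℕ → Space k → ℤ),
      (∀ j, ∃ C, LipschitzWith C (f j)) ∧ (∀ j, Measurable (θ j)) ∧
      (∑' j, pushMass (f j) (θ j)) ≠ ∞ ∧
      ∀ ω : Form n k, HasSum (fun j => ∫ y, pushIntegrand (f j) (θ j) ω y) (T ω) := Iff.rfl

theorem stronglyMeasurable_pushIntegrand {f : Space k → Space n} (hf : Continuous f)
    {θ : Space k → ℤ} (hθ : Measurable θ) (ω : Form n k) :
    StronglyMeasurable (pushIntegrand f θ ω) := by
  have h1 : StronglyMeasurable fun y => ω (f y) :=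
    (ω.continuous.comp hf).stronglyMeasurable
  have h2 : StronglyMeasurable fun y => fun a : Fin k =>
      fderiv ℝ f y (EuclideanSpace.single a (1 : ℝ)) :=
    (measurable_pi_lambda _ fun a => measurable_fderiv_apply_const ℝ f _).stronglyMeasurable
  have h3 : StronglyMeasurable fun y => (θ y : ℝ) :=
    ((measurable_of_countable fun m : ℤ => (m : ℝ)).comp hθ).stronglyMeasurable
  have h4 : Continuous fun q : Covector n k × (Fin k → Space n) => q.1 q.2 := continuous_eval
  exact h3.mul (h4.comp_stronglyMeasurable (h1.prodMk h2))

theorem enorm_pushIntegrand_le {f : Space k → Space n} {θ : Space k → ℤ} {ω : Form n k} {c : ℝ}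
    (hω : ∀ x, ‖ω x‖ ≤ c) (y : Space k) : ‖pushIntegrand f θ ω y‖ₑ ≤ ENNReal.ofReal c *
      (‖(θ y : ℝ)‖ₑ * ENNReal.ofReal (LinearMap.normDet (fderiv ℝ f y).toLinearMap)) := by
  rw [pushIntegrand, enorm_mul, mul_left_comm]
  gcongr
  rw [← ENNReal.ofReal_mul ((norm_nonneg _).trans (hω 0)), ← ofReal_norm]
  refine ENNReal.ofReal_le_ofReal ((abs_apply_le_norm_mul_normDet _ _).trans ?_)
  exact mul_le_mul_of_nonneg_right (hω _) (LinearMap.normDet_nonneg _)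

theorem lintegral_pushIntegrand_le {f : Space k → Space n} {θ : Space k → ℤ} {ω : Form n k}
    {c : ℝ} (hω : ∀ x, ‖ω x‖ ≤ c) :
    ∫⁻ y, ‖pushIntegrand f θ ω y‖ₑ ≤ ENNReal.ofReal c * pushMass f θ :=
  (lintegral_mono fun y => enorm_pushIntegrand_le hω y).trans_eq
    (lintegral_const_mul' _ _ ENNReal.ofReal_ne_top)

theorem integrable_pushIntegrand {f : Space k → Space n} (hf : Continuous f)
    {θ : Space k → ℤ} (hθ : Measurable θ) (hm : pushMass f θ ≠ ∞) (ω : Form n k) :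
    Integrable (pushIntegrand f θ ω) := by
  obtain ⟨c, -, hc⟩ := exists_bound ω
  exact ⟨(stronglyMeasurable_pushIntegrand hf hθ ω).aestronglyMeasurable,
    (lintegral_pushIntegrand_le hc).trans_lt (by finiteness)⟩

theorem norm_integral_pushIntegrand_le {f : Space k → Space n} {θ : Space k → ℤ}
    (hm : pushMass f θ ≠ ∞) {ω : Form n k} {c : ℝ} (hω : ∀ x, ‖ω x‖ ≤ c) :
    ‖∫ y, pushIntegrand f θ ω y‖ ≤ c * (pushMass f θ).toReal := by
  have hc : 0 ≤ c := (norm_nonneg _).trans (hω 0)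
  rw [← ENNReal.ofReal_le_ofReal_iff (by positivity), ofReal_norm, ENNReal.ofReal_mul hc,
    ENNReal.ofReal_toReal hm]
  exact (enorm_integral_le_lintegral_enorm _).trans (lintegral_pushIntegrand_le hω)

theorem isRectifiable_of_single {T : Current n k} {f : Space k → Space n} {θ : Space k → ℤ}
    (hf : ∃ C, LipschitzWith C f) (hθ : Measurable θ) (hm : pushMass f θ ≠ ∞)
    (hT : ∀ ω, T ω = ∫ y, pushIntegrand f θ ω y) : IsRectifiable T := by
  refine isRectifiable_iff.2 ⟨fun _ => f, fun j => if j = 0 then θ else 0, fun _ => hf, fun j => ?_,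
    ?_, fun ω => ?_⟩
  · dsimp only
    split_ifs
    exacts [hθ, measurable_const]
  · rw [tsum_eq_single 0 fun j hj => by simp [hj, pushMass]]
    simpa using hm
  · rw [hT]
    exact hasSum_single (f := fun j : ℕ =>
      ∫ y, pushIntegrand f (if j = 0 then θ else 0) ω y) 0 fun j hj => by simp [hj, pushIntegrand]

theorem IsRectifiable.add {T T' : Current n k} (h : IsRectifiable T) (h' : IsRectifiable T') :
    IsRectifiable (T + T') := by
  obtain ⟨f, θ, hf, hθ, hm, hT⟩ := isRectifiable_iff.1 h
  obtain ⟨f', θ', hf', hθ', hm', hT'⟩ := isRectifiable_iff.1 h'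
  let e := Equiv.natSumNatEquivNat
  let F : ℕ ⊕ ℕ → Space k → Space n := Sum.elim f f'
  let Θ : ℕ ⊕ ℕ → Space k → ℤ := Sum.elim θ θ'
  refine isRectifiable_iff.2 ⟨F ∘ e.symm, Θ ∘ e.symm, fun j => ?_, fun j => ?_, ?_, fun ω => ?_⟩
  · simp only [Function.comp_apply]
    rcases e.symm j with i | i
    exacts [hf i, hf' i]
  · simp only [Function.comp_apply]
    rcases e.symm j with i | i
    exacts [hθ i, hθ' i]
  · have := e.symm.tsum_eq fun s => pushMass (F s) (Θ s)
    simp only [Function.comp_apply]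
    rw [this, ENNReal.summable.tsum_sum ENNReal.summable]
    exact ENNReal.add_ne_top.2 ⟨hm, hm'⟩
  · have : HasSum (fun s => ∫ y, pushIntegrand (F s) (Θ s) ω y) (T ω + T' ω) := (hT ω).sum (hT' ω)
    exact e.symm.hasSum_iff.2 this

theorem IsRectifiable.neg {T : Current n k} (h : IsRectifiable T) : IsRectifiable (-T) := by
  obtain ⟨f, θ, hf, hθ, hm, hT⟩ := isRectifiable_iff.1 h
  refine isRectifiable_iff.2 ⟨f, fun j => -θ j, hf, fun j => (hθ j).neg, ?_, fun ω => ?_⟩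
  · have e : ∀ j, pushMass (f j) (-θ j) = pushMass (f j) (θ j) := fun j => by simp [pushMass]
    simpa only [e] using hm
  · have e : ∀ j, ∫ y, pushIntegrand (f j) (-θ j) ω y = -∫ y, pushIntegrand (f j) (θ j) ω y :=
      fun j => by
        rw [← integral_neg]
        simp [pushIntegrand]
    simp only [e]
    exact (hT ω).neg

theorem IsRectifiable.sub {T T' : Current n k} (h : IsRectifiable T) (h' : IsRectifiable T') :
    IsRectifiable (T - T') := sub_eq_add_neg T T' ▸ h.add h'.neg

/-- The restriction of a rectifiable current to an open set is rectifiable. -/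
theorem IsRectifiable.of_tendsto_cutoff {T T' : Current n k} (h : IsRectifiable T)
    {O : Set (Space n)} (hO : IsOpen O) {χ : ℕ → Space n → ℝ} (hχ : IsCutoff O χ)
    (hT' : ∀ ω, Tendsto (fun i => T (smulForm (χ i) (hχ.contDiff i) ω)) atTop (𝓝 (T' ω))) :
    IsRectifiable T' := by
  obtain ⟨f, θ, hf, hθ, hm, hT⟩ := isRectifiable_iff.1 h
  have hfc : ∀ j, Continuous (f j) := fun j => (hf j).choose_spec.continuous
  -- The Lipschitz maps are kept; only the integer multiplicities are cut off, to the preimages of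
  -- `O`.
  let θ' : ℕ → Space k → ℤ := fun j => (f j ⁻¹' O).indicator (θ j)
  have hle : ∀ j, pushMass (f j) (θ' j) ≤ pushMass (f j) (θ j) := fun j =>
    lintegral_mono fun y => by
      by_cases hy : y ∈ f j ⁻¹' O <;> simp [θ', hy]
  have hmj : ∀ j, pushMass (f j) (θ j) ≠ ∞ := fun j => ENNReal.ne_top_of_tsum_ne_top hm j
  have hmj' : ∀ j, pushMass (f j) (θ' j) ≠ ∞ := fun j => ne_top_of_le_ne_top (hmj j) (hle j)
  have hθ' : ∀ j, Measurable (θ' j) := fun j =>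
    (hθ j).indicator (hO.preimage (hfc j)).measurableSet
  have hm' : (∑' j, pushMass (f j) (θ' j)) ≠ ∞ :=
    ne_top_of_le_ne_top hm (ENNReal.tsum_le_tsum hle)
  refine isRectifiable_iff.2 ⟨f, θ', hf, hθ', hm', fun ω => ?_⟩
  obtain ⟨c, hc0, hc⟩ := exists_bound ω
  have hs : Summable fun j => c * (pushMass (f j) (θ j)).toReal :=
    (ENNReal.summable_toReal hm).mul_left c
  have hs' : Summable fun j => ∫ y, pushIntegrand (f j) (θ' j) ω y :=
    Summable.of_norm_bounded (g := fun j => c * (pushMass (f j) (θ' j)).toReal)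
      ((ENNReal.summable_toReal hm').mul_left c) fun j => norm_integral_pushIntegrand_le (hmj' j) hc
  have hlim : Tendsto (fun i => ∑' j, ∫ y, pushIntegrand (f j) (θ j)
      (smulForm (χ i) (hχ.contDiff i) ω) y) atTop (𝓝 (∑' j, ∫ y, pushIntegrand (f j) (θ' j) ω y)) := by
    refine tendsto_tsum_of_dominated_convergence hs (fun j => ?_) (.of_forall fun i j => ?_)
    · refine tendsto_integral_of_dominated_convergence (fun y => ‖pushIntegrand (f j) (θ j) ω y‖)
        (fun i => (stronglyMeasurable_pushIntegrand (hfc j) (hθ j) _).aestronglyMeasurable)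
        (integrable_pushIntegrand (hfc j) (hθ j) (hmj j) ω).norm
        (fun i => .of_forall fun y => ?_) (.of_forall fun y => ?_)
      · rw [pushIntegrand, smulForm_apply, ContinuousAlternatingMap.smul_apply, smul_eq_mul,
          mul_left_comm, norm_mul]
        exact mul_le_of_le_one_left (norm_nonneg _) (hχ.abs_le_one i _)
      · have := (hχ.tendsto_indicator (f j y)).mul_const (pushIntegrand (f j) (θ j) ω y)
        convert this using 2 with i
        · rw [pushIntegrand, smulForm_apply, ContinuousAlternatingMap.smul_apply, smul_eq_mul,
            mul_left_comm]; rfl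
        · by_cases hy : f j y ∈ O <;> simp [θ', pushIntegrand, hy]
    · refine norm_integral_pushIntegrand_le (hmj j) fun x => ?_
      rw [smulForm_apply, norm_smul]
      exact (mul_le_of_le_one_left (norm_nonneg _) (hχ.abs_le_one i x)).trans (hc x)
  have := tendsto_nhds_unique (hT' ω) (hlim.congr fun i => (hT _).tsum_eq)
  rw [this]
  exact hs'.hasSum

end

section

variable {n k p : ℕ}

/-! ### Coordinate hyperplanes -/

/-- The linear embedding of `ℝᵖ` in `ℝᵖ⁺¹` that skips the `i`-th coordinate. -/
def faceMap (i : Fin (p + 1)) : Space p →L[ℝ] Space (p + 1) :=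
  ∑ b, (EuclideanSpace.proj b : Space p →L[ℝ] ℝ).smulRight (frame (p + 1) (i.succAbove b))

/-- The affine embedding of `ℝᵖ` in `ℝᵖ⁺¹` as the hyperplane `xᵢ = a`. -/
def slice (i : Fin (p + 1)) (a : ℝ) (y : Space p) : Space (p + 1) :=
  a • frame (p + 1) i + faceMap i y

theorem faceMap_apply (i : Fin (p + 1)) (y : Space p) :
    faceMap i y = ∑ b, y b • frame (p + 1) (i.succAbove b) := by
  simp [faceMap, sum_apply]

theorem frame_apply (i j : Fin n) : frame n i j = if j = i then 1 else 0 := by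
  simp [frame]

theorem slice_eq (i : Fin (p + 1)) (a : ℝ) (y : Space p) :
    slice i a y = WithLp.toLp 2 (i.insertNth a (WithLp.ofLp y) : Fin (p + 1) → ℝ) := by
  ext j
  have h : ∀ j, slice i a y j = a * frame (p + 1) i j +
      ∑ b, y b * frame (p + 1) (i.succAbove b) j := fun j => by
    simp [slice, faceMap_apply]
  rw [h]
  refine Fin.succAboveCases i ?_ (fun b => ?_) j
  · simp [frame_apply, Fin.ne_succAbove]
  · simp [frame_apply, Fin.succAbove_ne]

theorem slice_apply_self (i : Fin (p + 1)) (a : ℝ) (y : Space p) : slice i a y i = a := by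
  simp [slice_eq]

theorem lipschitzWith_slice (i : Fin (p + 1)) (a : ℝ) : ∃ C, LipschitzWith C (slice i a) :=
  ⟨‖faceMap i‖₊, by
    have := (LipschitzWith.const (a • frame (p + 1) i)).add (faceMap i).lipschitz
    rw [zero_add] at this
    exact this⟩

theorem fderiv_slice (i : Fin (p + 1)) (a : ℝ) (y : Space p) :
    fderiv ℝ (slice i a) y = faceMap i := by
  change fderiv ℝ (fun y => a • frame (p + 1) i + faceMap i y) y = _
  rw [fderiv_const_add]
  exact (faceMap i).fderiv

theorem faceMap_single (i : Fin (p + 1)) (b : Fin p) :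
    faceMap i (EuclideanSpace.single b (1 : ℝ)) = frame (p + 1) (i.succAbove b) := by
  simp [faceMap_apply]

theorem measurePreserving_slice (i : Fin (p + 1)) :
    MeasurePreserving (fun q : ℝ × Space p => slice i q.1 q.2)
      (volume.prod volume) volume := by
  have h1 : MeasurePreserving (Prod.map id WithLp.ofLp : ℝ × Space p → ℝ × (Fin p → ℝ))
      (volume.prod volume) (volume.prod volume) :=
    (MeasurePreserving.id volume).prod (PiLp.volume_preserving_ofLp (Fin p))
  have h2 := (volume_preserving_piFinSuccAbove (fun _ : Fin (p + 1) => ℝ) i).symm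
  have h3 := PiLp.volume_preserving_toLp (Fin (p + 1))
  have := h3.comp (h2.comp h1)
  have e : (fun q : ℝ × Space p => slice i q.1 q.2) = WithLp.toLp 2 ∘
      (MeasurableEquiv.piFinSuccAbove (fun _ : Fin (p + 1) => ℝ) i).symm ∘
        Prod.map id WithLp.ofLp := funext fun q => slice_eq i q.1 q.2
  rw [e]
  exact this

theorem measurableEmbedding_slice (i : Fin (p + 1)) :
    MeasurableEmbedding (fun q : ℝ × Space p => slice i q.1 q.2) := by
  have h1 : MeasurableEmbedding (Prod.map id WithLp.ofLp : ℝ × Space p → ℝ × (Fin p → ℝ)) :=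
    ((MeasurableEquiv.refl ℝ).prodCongr
      (MeasurableEquiv.toLp 2 (Fin p → ℝ)).symm).measurableEmbedding
  have h2 := (MeasurableEquiv.piFinSuccAbove (fun _ : Fin (p + 1) => ℝ) i).symm.measurableEmbedding
  have h3 := (MeasurableEquiv.toLp 2 (Fin (p + 1) → ℝ)).measurableEmbedding
  have := h3.comp (h2.comp h1)
  have e : (fun q : ℝ × Space p => slice i q.1 q.2) = WithLp.toLp 2 ∘
      (MeasurableEquiv.piFinSuccAbove (fun _ : Fin (p + 1) => ℝ) i).symm ∘
        Prod.map id WithLp.ofLp := funext fun q => slice_eq i q.1 q.2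
  rw [e]
  exact this

theorem integrable_slice {i : Fin (p + 1)} {g : Space (p + 1) → ℝ} (hg : Integrable g) :
    Integrable (fun q : ℝ × Space p => g (slice i q.1 q.2)) (volume.prod volume) :=
  ((measurePreserving_slice i).integrable_comp_emb (measurableEmbedding_slice i)).2 hg

theorem integral_slice (i : Fin (p + 1)) {g : Space (p + 1) → ℝ} (hg : Integrable g) :
    ∫ x, g x = ∫ a, ∫ y, g (slice i a y) := by
  rw [← (measurePreserving_slice i).integral_comp (measurableEmbedding_slice i),
    integral_prod _ (integrable_slice hg)]

/-! ### A countable dense family of forms -/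

/-- Through `ω ↦ (ω, dω)` the forms supported in one ball sit in a second countable space of
continuous maps. A countable dense family lets the exceptional null set of slicing heights be chosen
independently of the form. -/
theorem exists_countable_approx (n k : ℕ) (m : ℕ) : ∃ D : Set (Form n k), D.Countable ∧
    ∀ ω : Form n k, tsupport ω ⊆ Metric.closedBall 0 m → ∃ u : ℕ → Form n k, (∀ j, u j ∈ D) ∧
      (∀ x, Tendsto (fun j => u j x) atTop (𝓝 (ω x))) ∧
      (∀ x, Tendsto (fun j => extD n k (u j) x) atTop (𝓝 (extD n k ω x))) ∧
      ∃ C, 0 ≤ C ∧ ∀ᶠ j in atTop, ∀ x, ‖u j x‖ ≤ C ∧ ‖extD n k (u j) x‖ ≤ C := by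
  let S := {ω : Form n k // tsupport ω ⊆ Metric.closedBall 0 m}
  let J : S → C(Space n, Covector n k) × C(Space n, Covector n (k + 1)) := fun ω =>
    (⟨ω.1, ω.1.continuous⟩, ⟨extD n k ω.1, (extD n k ω.1).continuous⟩)
  let _ : TopologicalSpace S := TopologicalSpace.induced J inferInstance
  have hJ : Topology.IsInducing J := ⟨rfl⟩
  have : ProperSpace (Covector n k) := FiniteDimensional.proper ℝ _
  have : ProperSpace (Covector n (k + 1)) := FiniteDimensional.proper ℝ _
  have : SecondCountableTopology S := hJ.secondCountableTopology
  obtain ⟨D, hDc, hD⟩ := TopologicalSpace.exists_countable_dense S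
  refine ⟨Subtype.val '' D, hDc.image _, fun ω hω => ?_⟩
  obtain ⟨u, huD, hu⟩ := mem_closure_iff_seq_limit.1 (hD ⟨ω, hω⟩)
  have hJu : Tendsto (fun j => J (u j)) atTop (𝓝 (J ⟨ω, hω⟩)) :=
    (hJ.continuous.tendsto _).comp hu
  rw [Prod.tendsto_iff] at hJu
  have h1 := ContinuousMap.tendsto_iff_forall_isCompact_tendstoUniformlyOn.1 hJu.1
  have h2 := ContinuousMap.tendsto_iff_forall_isCompact_tendstoUniformlyOn.1 hJu.2
  refine ⟨fun j => (u j).1, fun j => ⟨_, huD j, rfl⟩, fun x => ?_, fun x => ?_, ?_⟩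
  · exact (h1 {x} isCompact_singleton).tendsto_at rfl
  · exact (h2 {x} isCompact_singleton).tendsto_at rfl
  obtain ⟨C₁, hC₁, hb₁⟩ := exists_bound ω
  obtain ⟨C₂, hC₂, hb₂⟩ := exists_bound (extD n k ω)
  have hK := isCompact_closedBall (0 : Space n) (m : ℝ)
  have e1 := Metric.tendstoUniformlyOn_iff.1 (h1 _ hK) 1 one_pos
  have e2 := Metric.tendstoUniformlyOn_iff.1 (h2 _ hK) 1 one_pos
  refine ⟨C₁ + C₂ + 1, by positivity, ?_⟩
  filter_upwards [e1, e2] with j hj1 hj2 x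
  by_cases hx : x ∈ Metric.closedBall (0 : Space n) (m : ℝ)
  · have a1 : dist (ω x) ((u j).1 x) < 1 := hj1 x hx
    have a2 : dist (extD n k ω x) (extD n k (u j).1 x) < 1 := hj2 x hx
    rw [dist_comm, dist_eq_norm] at a1 a2
    constructor
    · have := norm_le_norm_add_norm_sub' ((u j).1 x) (ω x)
      linarith [hb₁ x]
    · have := norm_le_norm_add_norm_sub' (extD n k (u j).1 x) (extD n k ω x)
      linarith [hb₂ x]
  · have z1 : (u j).1 x = 0 := by
      by_contra h
      exact hx ((u j).2 (subset_tsupport _ h))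
    have z2 : extD n k (u j).1 x = 0 := by
      by_contra h
      exact hx ((u j).2 (tsupport_extD_subset _ (subset_tsupport _ h)))
    rw [z1, z2, norm_zero, norm_zero]
    constructor <;> positivity

/-! ### Primitives of test functions -/

/-- The tail integral is the smooth weight, with derivative `-φ`, that arises when half-space
integrals are averaged against `φ`. -/
theorem exists_tail_integral {φ : ℝ → ℝ} (hφ : ContDiff ℝ ((⊤ : ℕ∞) : WithTop ℕ∞) φ)
    (hs : HasCompactSupport φ) :
    ContDiff ℝ ((⊤ : ℕ∞) : WithTop ℕ∞) (fun t => ∫ a in Set.Ioi t, φ a) ∧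
      ∀ t, HasDerivAt (fun t => ∫ a in Set.Ioi t, φ a) (-φ t) t := by
  have hi : Integrable φ := hφ.continuous.integrable_of_hasCompactSupport hs
  have e : (fun t => ∫ a in Set.Ioi t, φ a) =
      fun t => (∫ a in Set.Ioi (0 : ℝ), φ a) - ∫ a in (0 : ℝ)..t, φ a := by
    ext t
    rw [← intervalIntegral.integral_Ioi_sub_Ioi' hi.integrableOn hi.integrableOn, sub_sub_cancel]
  have hd : ∀ t, HasDerivAt (fun t => ∫ a in Set.Ioi t, φ a) (-φ t) t := fun t => by
    rw [e]
    exact (hφ.continuous.integral_hasStrictDerivAt 0 t).hasDerivAt.const_sub _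
  refine ⟨contDiff_infty_iff_deriv.2 ⟨fun t => (hd t).differentiableAt, ?_⟩, hd⟩
  rw [show deriv (fun t => ∫ a in Set.Ioi t, φ a) = fun t => -φ t from funext fun t => (hd t).deriv]
  exact hφ.neg

end

section

variable {n k p : ℕ}

/-! ### Slicing by coordinate half spaces -/

theorem measurableSet_coord_lt (i : Fin n) (a : ℝ) : MeasurableSet {x : Space n | x i < a} :=
  (isOpen_lt (by fun_prop) continuous_const).measurableSet

theorem integrable_indicator_lt {m : Measure (Space n)} [SFinite m] {ν : Measure ℝ} [SFinite ν]
    (i : Fin n) {φ : ℝ → ℝ} (hφ : Integrable φ ν) {G : Space n → ℝ} (hG : Integrable G m) :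
    Integrable (fun q : ℝ × Space n => {x : Space n | x i < q.1}.indicator
      (fun x => φ q.1 * G x) q.2) (ν.prod m) := by
  have hs : MeasurableSet {q : ℝ × Space n | q.2 i < q.1} :=
    (isOpen_lt (by fun_prop) (by fun_prop)).measurableSet
  exact (hφ.mul_prod hG).indicator hs

theorem locallyIntegrable_setIntegral_lt {m : Measure (Space n)} [SFinite m] (i : Fin n)
    {G : Space n → ℝ} (hG : Integrable G m) :
    LocallyIntegrable fun a : ℝ => ∫ x in {x | x i < a}, G x ∂m := by
  refine (locallyIntegrable_iff).2 fun K hK => ?_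
  have : IsFiniteMeasure ((volume : Measure ℝ).restrict K) :=
    ⟨by simpa using hK.measure_lt_top⟩
  have := (integrable_indicator_lt (ν := volume.restrict K) i
    (integrable_const (1 : ℝ)) hG).integral_prod_left
  refine this.congr (ae_of_all _ fun a => ?_)
  simp only [one_mul]
  exact integral_indicator (measurableSet_coord_lt i a)

/-- Fubini: averaging the sharp cutoffs `xᵢ < a` over `a` with weight `φ` gives a smooth function of
`xᵢ`, against which currents can be tested. -/
theorem integral_mul_setIntegral_lt {m : Measure (Space n)} [SFinite m] (i : Fin n)
    {G : Space n → ℝ} (hG : Integrable G m) {φ : ℝ → ℝ} (hφ : Integrable φ) :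
    ∫ a, φ a * ∫ x in {x | x i < a}, G x ∂m = ∫ x, (∫ a in Set.Ioi (x i), φ a) * G x ∂m := by
  have e1 : ∀ a, φ a * ∫ x in {x | x i < a}, G x ∂m =
      ∫ x, {x : Space n | x i < a}.indicator (fun x => φ a * G x) x ∂m := fun a => by
    rw [integral_indicator (measurableSet_coord_lt i a), integral_const_mul]
  simp_rw [e1]
  rw [integral_integral_swap (integrable_indicator_lt i hφ hG)]
  refine integral_congr_ae (ae_of_all _ fun x => ?_)
  change ∫ a, (Set.Ioi (x i)).indicator (fun a => φ a * G x) a = _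
  rw [integral_indicator measurableSet_Ioi, integral_mul_const]

theorem alternatizeUncurryFin_coord (i : Fin (p + 1)) (c : ℝ) (α : Covector (p + 1) p) :
    ContinuousAlternatingMap.alternatizeUncurryFin
      ((c • (EuclideanSpace.proj i : Space (p + 1) →L[ℝ] ℝ)).smulRight α) (frame (p + 1)) =
      (-1) ^ (i : ℕ) * c * α fun b => frame (p + 1) (i.succAbove b) := by
  rw [ContinuousAlternatingMap.alternatizeUncurryFin_apply]
  rw [Finset.sum_eq_single i]
  · have hp : (EuclideanSpace.proj i : Space (p + 1) →L[ℝ] ℝ) (frame (p + 1) i) = 1 :=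
      (frame_apply i i).trans (if_pos rfl)
    simp only [hp, zsmul_eq_mul, ContinuousLinearMap.smulRight_apply, FunLike.coe_smul,
      Pi.smul_apply, ContinuousAlternatingMap.smul_apply, smul_eq_mul,
      mul_one, Int.cast_pow, Int.cast_neg, Int.cast_one, mul_assoc]
    rfl
  · intro j _ hj
    simp [frame_apply, hj.symm]
  · simp

theorem integrable_mul_slice {θ : Space (p + 1) → ℝ} (hθ : Integrable θ) (i : Fin (p + 1)) :
    ∀ᵐ a, Integrable fun y => θ (slice i a y) :=
  (integrable_slice hθ).prod_right_ae

/-- It suffices to test the identity, as a function of `a`, against every smooth `φ`. With `t` the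
tail integral of `φ`, the boundary is evaluated on `t(xᵢ) ω` in two ways: by the Leibniz rule, where
`dt = -φ dxᵢ` yields the slice term through Fubini, and by the representation `(μ, ξ)`. -/
theorem slicing_single {θ : Space (p + 1) → ℝ} (hθ : Integrable θ) {μ : Measure (Space (p + 1))}
    [IsFiniteMeasure μ] {ξ : Space (p + 1) → KVector (p + 1) p} (hξ : Integrable ξ μ)
    (h : boundary (topCurrent θ) = byIntegration μ ξ) (i : Fin (p + 1)) (ω : Form (p + 1) p) :
    ∀ᵐ a, (∫ x in {x | x i < a}, θ x * extD (p + 1) p ω x (frame (p + 1))) =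
      (∫ x in {x | x i < a}, pairing (p + 1) p (ω x) (ξ x) ∂μ) +
        (-1) ^ (i : ℕ) * ∫ y, θ (slice i a y) *
          ω (slice i a y) fun b => frame (p + 1) (i.succAbove b) := by
  have hG0 := integrable_mul_form hθ (extD (p + 1) p ω) (frame (p + 1))
  have hG1 := integrable_pairing hξ ω
  have hg2 := integrable_mul_form hθ ω fun b => frame (p + 1) (i.succAbove b)
  have hs := (integrable_slice (i := i) hg2).integral_prod_left
  have l0 := locallyIntegrable_setIntegral_lt i hG0
  have l1 := locallyIntegrable_setIntegral_lt i hG1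
  have l2 := (hs.const_mul ((-1) ^ (i : ℕ))).locallyIntegrable
  have key := ae_eq_zero_of_integral_contDiff_smul_eq_zero ((l0.sub l1).sub l2) fun φ hφ hc => by
    obtain ⟨hh, hd⟩ := exists_tail_integral hφ hc
    have hi : Integrable φ := hφ.continuous.integrable_of_hasCompactSupport hc
    set t : ℝ → ℝ := fun t => ∫ a in Set.Ioi t, φ a with ht
    have hη : ContDiff ℝ ((⊤ : ℕ∞) : WithTop ℕ∞) fun x : Space (p + 1) => t (x i) :=
      hh.comp (EuclideanSpace.proj i : Space (p + 1) →L[ℝ] ℝ).contDiff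
    have hf : ∀ x, fderiv ℝ (fun x : Space (p + 1) => t (x i)) x =
        (-φ (x i)) • (EuclideanSpace.proj i : Space (p + 1) →L[ℝ] ℝ) := fun x =>
      (HasDerivAt.comp_hasFDerivAt (h₂ := t) x (hd (x i))
        (EuclideanSpace.proj i : Space (p + 1) →L[ℝ] ℝ).hasFDerivAt).fderiv
    have e1 : boundary (topCurrent θ) (smulForm _ hη ω) =
        (∫ x, t (x i) * (θ x * extD (p + 1) p ω x (frame (p + 1)))) -
        ∫ x, (-1) ^ (i : ℕ) * (φ (x i) * (θ x * ω x fun b => frame (p + 1) (i.succAbove b))) := by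
      have hφ' : ContDiff ℝ ((⊤ : ℕ∞) : WithTop ℕ∞) fun x : Space (p + 1) => φ (x i) :=
        hφ.comp (EuclideanSpace.proj i : Space (p + 1) →L[ℝ] ℝ).contDiff
      have i0 := integrable_mul_form hθ (smulForm _ hη (extD (p + 1) p ω)) (frame (p + 1))
      have i2 := integrable_mul_form hθ (smulForm _ hφ' ω)
        fun b => frame (p + 1) (i.succAbove b)
      simp only [smulForm_apply, ContinuousAlternatingMap.smul_apply, smul_eq_mul] at i0 i2
      rw [← integral_sub (i0.congr (ae_of_all _ fun x => by ring))
        ((i2.congr (ae_of_all _ fun x => by ring)).const_mul _), boundary_apply,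
        topCurrent_apply hθ]
      refine integral_congr_ae (ae_of_all _ fun x => ?_)
      simp only [extD_smulForm, hf, ContinuousAlternatingMap.add_apply,
        ContinuousAlternatingMap.smul_apply, alternatizeUncurryFin_coord, smul_eq_mul]
      ring
    have e2 : boundary (topCurrent θ) (smulForm _ hη ω) =
        ∫ x, t (x i) * pairing (p + 1) p (ω x) (ξ x) ∂μ := by
      rw [h, byIntegration_apply hξ]
      simp [smulForm_apply]
    have c0 := l0.integrable_smul_left_of_hasCompactSupport hφ.continuous hc
    have c1 := l1.integrable_smul_left_of_hasCompactSupport hφ.continuous hc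
    have c2 := l2.integrable_smul_left_of_hasCompactSupport hφ.continuous hc
    have hφs : ∀ a, ∫ y, φ (slice i a y i) * (θ (slice i a y) *
        ω (slice i a y) fun b => frame (p + 1) (i.succAbove b)) =
        φ a * ∫ y, θ (slice i a y) *
          ω (slice i a y) fun b => frame (p + 1) (i.succAbove b) := fun a => by
      simp only [slice_apply_self, integral_const_mul]
    have hφg : Integrable fun x : Space (p + 1) => φ (x i) * (θ x *
        ω x fun b => frame (p + 1) (i.succAbove b)) := by
      have hφ' : ContDiff ℝ ((⊤ : ℕ∞) : WithTop ℕ∞) fun x : Space (p + 1) => φ (x i) :=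
        hφ.comp (EuclideanSpace.proj i : Space (p + 1) →L[ℝ] ℝ).contDiff
      exact (integrable_mul_form hθ (smulForm _ hφ' ω)
        fun b => frame (p + 1) (i.succAbove b)).congr (ae_of_all _ fun x => by
          simp only [smulForm_apply, ContinuousAlternatingMap.smul_apply, smul_eq_mul]; ring)
    have e3 := integral_slice i hφg
    simp only [hφs] at e3
    have e4 := e1.symm.trans e2
    rw [integral_const_mul, e3, ← integral_mul_setIntegral_lt i hG0 hi,
      ← integral_mul_setIntegral_lt i hG1 hi] at e4
    simp only [Pi.sub_apply, smul_sub]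
    refine ((integral_sub (c0.sub c1) c2).trans
      (congrArg (· - _) (integral_sub c0 c1))).trans ?_
    simp only [smul_eq_mul, mul_left_comm (φ _) ((-1 : ℝ) ^ (i : ℕ)), integral_const_mul]
    linarith
  filter_upwards [key] with a ha
  simp only [Pi.sub_apply] at ha
  linarith

/-- For a fixed form the identity holds off a null set of heights that depends on the form. A
countable approximating family gives one null set, and each of the three terms passes to the limit
by dominated convergence. -/
theorem slicing {θ : Space (p + 1) → ℝ} (hθ : Integrable θ) {μ : Measure (Space (p + 1))}
    [IsFiniteMeasure μ] {ξ : Space (p + 1) → KVector (p + 1) p} (hξ : Integrable ξ μ)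
    (h : boundary (topCurrent θ) = byIntegration μ ξ) (i : Fin (p + 1)) :
    ∀ᵐ a, (Integrable fun y => θ (slice i a y)) ∧ ∀ ω,
      boundary (topCurrent ({x : Space (p + 1) | x i < a}.indicator θ)) ω =
        byIntegration (μ.restrict {x | x i < a}) ξ ω +
          (-1) ^ (i : ℕ) * ∫ y, θ (slice i a y) *
            ω (slice i a y) fun b => frame (p + 1) (i.succAbove b) := by
  choose D hDc hD using exists_countable_approx (p + 1) p
  have hc : (⋃ m, D m).Countable := Set.countable_iUnion hDc
  filter_upwards [(ae_ball_iff hc).2 fun ω _ => slicing_single hθ hξ h i ω,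
    integrable_mul_slice hθ i] with a ha hia
  refine ⟨hia, fun ω => ?_⟩
  obtain ⟨m, hm⟩ : ∃ m : ℕ, tsupport ω ⊆ Metric.closedBall 0 m := by
    obtain ⟨R, hR⟩ := ω.hasCompactSupport.isCompact.isBounded.subset_closedBall
      (0 : Space (p + 1))
    obtain ⟨m, hm⟩ := exists_nat_ge R
    exact ⟨m, hR.trans (Metric.closedBall_subset_closedBall hm)⟩
  obtain ⟨u, huD, hu, hdu, C, hC, hb⟩ := hD m ω hm
  have hH := measurableSet_coord_lt i a
  rw [boundary_apply, topCurrent_apply (hθ.indicator hH), byIntegration_apply hξ.restrict]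
  have e : ∀ x, {x : Space (p + 1) | x i < a}.indicator θ x *
      extD (p + 1) p ω x (frame (p + 1)) = {x : Space (p + 1) | x i < a}.indicator
        (fun x => θ x * extD (p + 1) p ω x (frame (p + 1))) x := fun x =>
    (Set.indicator_mul_left _ θ fun x => extD (p + 1) p ω x (frame (p + 1))).symm
  simp only [e]
  rw [integral_indicator hH]
  have ev : ∀ {q : ℕ} (v : Fin q → Space (p + 1)),
      Continuous fun α : Covector (p + 1) q => α v := fun v =>
    (ContinuousAlternatingMap.apply ℝ (Space (p + 1)) ℝ v).continuous
  have t1 : Tendsto (fun j => ∫ x in {x | x i < a}, θ x *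
      extD (p + 1) p (u j) x (frame (p + 1))) atTop
      (𝓝 (∫ x in {x | x i < a}, θ x * extD (p + 1) p ω x (frame (p + 1)))) := by
    refine tendsto_integral_filter_of_dominated_convergence (fun x => ‖θ x‖ * C)
      (.of_forall fun j => (integrable_mul_form hθ _ _).restrict.aestronglyMeasurable)
      ?_ (hθ.norm.mul_const C).restrict
      (ae_of_all _ fun x => (((ev _).tendsto _).comp (hdu x)).const_mul _)
    filter_upwards [hb] with j hj
    refine ae_of_all _ fun x => ?_
    rw [norm_mul]
    exact mul_le_mul_of_nonneg_left ((abs_apply_le_norm _ norm_frame).trans (hj x).2)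
      (norm_nonneg _)
  have t2 : Tendsto (fun j => ∫ x in {x | x i < a}, pairing (p + 1) p (u j x) (ξ x) ∂μ) atTop
      (𝓝 (∫ x in {x | x i < a}, pairing (p + 1) p (ω x) (ξ x) ∂μ)) := by
    refine tendsto_integral_filter_of_dominated_convergence (fun x => C * ‖ξ x‖)
      (.of_forall fun j => (integrable_pairing hξ _).restrict.aestronglyMeasurable)
      ?_ (hξ.norm.const_mul C).restrict
      (ae_of_all _ fun x => (((pairing (p + 1) p).flip (ξ x)).continuous.tendsto _).comp (hu x))
    filter_upwards [hb] with j hj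
    exact ae_of_all _ fun x => (pairing_le _ _).trans
      (mul_le_mul_of_nonneg_right (hj x).1 (norm_nonneg _))
  have hsl : Continuous (slice i a) := (lipschitzWith_slice i a).choose_spec.continuous
  have t3 : Tendsto (fun j => ∫ y, θ (slice i a y) *
      u j (slice i a y) fun b => frame (p + 1) (i.succAbove b)) atTop
      (𝓝 (∫ y, θ (slice i a y) * ω (slice i a y) fun b => frame (p + 1) (i.succAbove b))) := by
    refine tendsto_integral_filter_of_dominated_convergence (fun y => ‖θ (slice i a y)‖ * C)
      (.of_forall fun j => hia.aestronglyMeasurable.mul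
        ((ev _).comp ((u j).continuous.comp hsl)).aestronglyMeasurable)
      ?_ (hia.norm.mul_const C)
      (ae_of_all _ fun y => (((ev _).tendsto _).comp (hu (slice i a y))).const_mul _)
    filter_upwards [hb] with j hj
    refine ae_of_all _ fun y => ?_
    rw [norm_mul]
    exact mul_le_mul_of_nonneg_left ((abs_apply_le_norm _ fun b => norm_frame _).trans
      (hj _).1) (norm_nonneg _)
  exact tendsto_nhds_unique t1 ((t2.add (t3.const_mul _)).congr fun j =>
    (ha (u j) (Set.mem_iUnion.2 ⟨m, huD j⟩)).symm)

end

section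

variable {n k p : ℕ}

/-! ### Densities whose boundary is rectifiable in an open set -/

theorem mass_add_lt_top {T T' : Current n k} (h : mass T < ∞) (h' : mass T' < ∞) :
    mass (T + T') < ∞ := by
  obtain ⟨M, hM, hT⟩ := mass_lt_top_iff.1 h
  obtain ⟨M', hM', hT'⟩ := mass_lt_top_iff.1 h'
  refine mass_lt_top_iff.2 ⟨M + M', by positivity, fun ω c hc => ?_⟩
  rw [add_mul]
  exact (abs_add_le _ _).trans (add_le_add (hT ω c hc) (hT' ω c hc))

/-- An integrable integer density whose boundary has finite mass and is rectifiable in `U`. -/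
structure HasRectifiableBoundary (U : Set (Space (p + 1))) (θ : Space (p + 1) → ℤ) : Prop where
  measurable : Measurable θ
  integrable : Integrable fun x => (θ x : ℝ)
  mass_lt_top : mass (boundary (topCurrent fun x => (θ x : ℝ))) < ∞
  isRectifiable : IsRectifiable (restrict (boundary (topCurrent fun x => (θ x : ℝ))) U)

theorem HasRectifiableBoundary.sub {U : Set (Space (p + 1))} (hU : IsOpen U)
    {θ θ' : Space (p + 1) → ℤ} (h : HasRectifiableBoundary U θ)
    (h' : HasRectifiableBoundary U θ') : HasRectifiableBoundary U fun x => θ x - θ' x := by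
  have e : boundary (topCurrent fun x => ((θ x - θ' x : ℤ) : ℝ)) =
      boundary (topCurrent fun x => (θ x : ℝ)) - boundary (topCurrent fun x => (θ' x : ℝ)) := by
    simp only [Int.cast_sub]
    rw [topCurrent_sub h.integrable h'.integrable, boundary_sub]
  refine ⟨h.measurable.sub h'.measurable, ?_, ?_, ?_⟩
  · simp only [Int.cast_sub]
    exact h.integrable.sub h'.integrable
  · rw [e]
    exact mass_sub_lt_top h.mass_lt_top h'.mass_lt_top
  · rw [e, restrict_sub hU h.mass_lt_top h'.mass_lt_top]
    exact h.isRectifiable.sub h'.isRectifiable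

/-- The new boundary is the old one restricted to the half space plus the slice. The slice is a
single affine image of `ℝᵖ` with multiplicity `±θ`, so it is rectifiable; the other part is
rectifiable by cutting off multiplicities. -/
theorem HasRectifiableBoundary.indicator_lt {U : Set (Space (p + 1))} (hU : IsOpen U)
    {θ : Space (p + 1) → ℤ} (h : HasRectifiableBoundary U θ) (i : Fin (p + 1)) :
    ∀ᵐ a, HasRectifiableBoundary U ({x | x i < a}.indicator θ) := by
  obtain ⟨μ, ξ, _, hξ, hT⟩ := exists_byIntegration h.mass_lt_top
  filter_upwards [slicing h.integrable hξ hT i] with a ⟨hia, ha⟩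
  have hHo : IsOpen {x : Space (p + 1) | x i < a} := isOpen_lt (by fun_prop) continuous_const
  have hH := measurableSet_coord_lt i a
  have ei : (fun x => (({x | x i < a}.indicator θ x : ℤ) : ℝ)) =
      {x : Space (p + 1) | x i < a}.indicator fun x => (θ x : ℝ) := by
    ext x
    by_cases hx : x ∈ {x : Space (p + 1) | x i < a} <;> simp [hx]
  set TH := boundary (topCurrent ({x : Space (p + 1) | x i < a}.indicator fun x => (θ x : ℝ)))
  set TB := byIntegration (μ.restrict {x | x i < a}) ξ
  have hsl : Measurable fun y => (-1) ^ (i : ℕ) * θ (slice i a y) :=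
    (h.measurable.comp (lipschitzWith_slice i a).choose_spec.continuous.measurable).const_mul _
  have hm : pushMass (slice i a) (fun y => (-1) ^ (i : ℕ) * θ (slice i a y)) ≠ ∞ := by
    simp only [pushMass, fderiv_slice]
    rw [lintegral_mul_const' _ _ ENNReal.ofReal_ne_top]
    refine ENNReal.mul_ne_top ?_ ENNReal.ofReal_ne_top
    have := (hia.const_mul ((-1) ^ (i : ℕ))).hasFiniteIntegral.ne
    push_cast
    exact this
  have hS : ∀ ω, (TH - TB) ω = ∫ y, pushIntegrand (slice i a)
      (fun y => (-1) ^ (i : ℕ) * θ (slice i a y)) ω y := fun ω => by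
    change TH ω - TB ω = _
    rw [ha ω, add_sub_cancel_left, ← integral_const_mul]
    refine integral_congr_ae (ae_of_all _ fun y => ?_)
    simp only [pushIntegrand, fderiv_slice, faceMap_single]
    push_cast
    ring
  have hSm : mass (TH - TB) < ∞ := mass_lt_top_iff.2 ⟨_, ENNReal.toReal_nonneg, fun ω c hc => by
    rw [hS, mul_comm]
    exact norm_integral_pushIntegrand_le hm hc⟩
  have hBm : mass TB < ∞ := mass_byIntegration_lt_top hξ.restrict
  have hSr : IsRectifiable (restrict (TH - TB) U) := by
    obtain ⟨χ, hχ⟩ := exists_isCutoff hU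
    exact (isRectifiable_of_single (lipschitzWith_slice i a) hsl hm hS).of_tendsto_cutoff hU hχ
      (tendsto_restrict hU hχ hSm)
  -- Restrictions to `U` and to the half space commute, so this current is the rectifiable one in
  -- `U`, cut off to the half space.
  have hBr : IsRectifiable (restrict TB U) := by
    have hr := h.isRectifiable
    rw [hT, restrict_byIntegration hU hξ] at hr
    obtain ⟨χ, hχ⟩ := exists_isCutoff hHo
    refine hr.of_tendsto_cutoff hHo hχ fun ω => ?_
    rw [restrict_byIntegration hU hξ.restrict, Measure.restrict_restrict hU.measurableSet,
      Set.inter_comm, ← Measure.restrict_restrict hH]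
    exact tendsto_byIntegration_smulForm hHo hχ hξ.restrict ω
  have hHm : mass TH < ∞ := by simpa using mass_add_lt_top hSm hBm
  refine ⟨h.measurable.indicator hH, ?_, ?_, ?_⟩
  · rw [ei]
    exact h.integrable.indicator hH
  · rw [ei]
    exact hHm
  · rw [ei]
    rw [restrict_sub hU hHm hBm] at hSr
    simpa using hSr.add hBr

theorem HasRectifiableBoundary.indicator_ge {U : Set (Space (p + 1))} (hU : IsOpen U)
    {θ : Space (p + 1) → ℤ} (h : HasRectifiableBoundary U θ) (i : Fin (p + 1)) :
    ∀ᵐ a, HasRectifiableBoundary U ({x | a ≤ x i}.indicator θ) := by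
  filter_upwards [h.indicator_lt hU i] with a ha
  convert h.sub hU ha using 1
  ext x
  by_cases hx : x i < a
  · simp [hx, Set.indicator, not_le.2 hx]
  · simp [hx, Set.indicator, not_lt.1 hx]

theorem exists_mem_Ioo_of_ae {P : ℝ → Prop} (h : ∀ᵐ a, P a) {s t : ℝ} (hst : s < t) :
    ∃ a ∈ Set.Ioo s t, P a := by
  by_contra! hc
  have : volume (Set.Ioo s t) = 0 := measure_mono_null (fun a ha => hc a ha) h
  rw [Real.volume_Ioo, ENNReal.ofReal_eq_zero] at this
  linarith

/-- Densities with rectifiable boundary can be cut off to boxes that approximate a given cube. -/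
theorem HasRectifiableBoundary.exists_box {U : Set (Space (p + 1))} (hU : IsOpen U)
    {θ : Space (p + 1) → ℤ} (h : HasRectifiableBoundary U θ) (x : Space (p + 1)) {r : ℝ}
    (hr : 0 < r) : ∃ a b : Fin (p + 1) → ℝ, (∀ i, x i - r < a i ∧ a i < x i - r / 2 ∧
      x i + r / 2 < b i ∧ b i < x i + r) ∧
      HasRectifiableBoundary U ({z | ∀ i, a i ≤ z i ∧ z i < b i}.indicator θ) := by
  have step : ∀ s : Finset (Fin (p + 1)), ∃ a b : Fin (p + 1) → ℝ,
      (∀ i, x i - r < a i ∧ a i < x i - r / 2 ∧ x i + r / 2 < b i ∧ b i < x i + r) ∧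
      HasRectifiableBoundary U ({z | ∀ i ∈ s, a i ≤ z i ∧ z i < b i}.indicator θ) := by
    intro s
    induction s using Finset.induction_on with
    | empty =>
      refine ⟨fun i => x i - 3 / 4 * r, fun i => x i + 3 / 4 * r, fun i => ?_, by simpa using h⟩
      refine ⟨?_, ?_, ?_, ?_⟩ <;> linarith
    | insert j s hj ih =>
      obtain ⟨a, b, hab, hg⟩ := ih
      obtain ⟨b', hb', hg'⟩ := exists_mem_Ioo_of_ae (hg.indicator_lt hU j)
        (show x j + r / 2 < x j + r by linarith)
      obtain ⟨a', ha', hg''⟩ := exists_mem_Ioo_of_ae (hg'.indicator_ge hU j)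
        (show x j - r < x j - r / 2 by linarith)
      refine ⟨Function.update a j a', Function.update b j b', fun i => ?_, ?_⟩
      · by_cases hi : i = j
        · subst hi
          simpa using ⟨ha'.1, ha'.2, hb'.1, hb'.2⟩
        · simpa [hi] using hab i
      · rw [Set.indicator_indicator, Set.indicator_indicator] at hg''
        convert hg'' using 2
        ext z
        have : ∀ i ∈ s, i ≠ j := fun i hi e => hj (e ▸ hi)
        simp only [Finset.forall_mem_insert, Set.mem_ofPred_eq, Set.mem_inter_iff,
          Function.update_self]
        constructor
        · rintro ⟨⟨h1, h2⟩, h3⟩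
          exact ⟨⟨h1, h2⟩, fun i hi => by simpa [this i hi] using h3 i hi⟩
        · rintro ⟨⟨h1, h2⟩, h3⟩
          exact ⟨⟨h1, h2⟩, fun i hi => by simpa [this i hi] using h3 i hi⟩
  obtain ⟨a, b, hab, hg⟩ := step Finset.univ
  exact ⟨a, b, hab, by simpa using hg⟩

end

section

open scoped symmDiff

variable {n k p : ℕ}

/-! ### Currents of sets and their differences -/

theorem integrable_indicator_one {F : Set (Space n)} (hF : NullMeasurableSet F)
    (hF' : volume F < ∞) : Integrable (F.indicator (1 : Space n → ℝ)) :=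
  IntegrableOn.integrable_indicator₀ (integrableOn_const hF'.ne) hF

theorem setCurrent_eq (F : Set (Space n)) :
    setCurrent F = topCurrent (F.indicator (1 : Space n → ℝ)) := by
  unfold setCurrent multCurrent
  congr 2
  ext
  simp

theorem setCurrent_sub {F G : Set (Space n)} (hF : NullMeasurableSet F) (hF' : volume F < ∞)
    (hG : NullMeasurableSet G) (hG' : volume G < ∞) : setCurrent F - setCurrent G =
      topCurrent (fun x => F.indicator 1 x - G.indicator (1 : Space n → ℝ) x) := by
  rw [setCurrent_eq, setCurrent_eq, topCurrent_sub (integrable_indicator_one hF hF')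
    (integrable_indicator_one hG hG')]

theorem setCurrent_congr_ae {F G : Set (Space n)} (hF : NullMeasurableSet F) (hF' : volume F < ∞)
    (h : F =ᵐ[volume] G) : setCurrent F = setCurrent G := by
  rw [setCurrent_eq, setCurrent_eq]
  exact topCurrent_congr_ae (integrable_indicator_one hF hF') (indicator_ae_eq_of_ae_eq_set h)

theorem mass_setCurrent_sub {F G : Set (Space n)} (hF : NullMeasurableSet F)
    (hF' : volume F < ∞) (hG : NullMeasurableSet G) (hG' : volume G < ∞) :
    mass (setCurrent F - setCurrent G) =
      ENNReal.ofReal (‖volForm n‖⁻¹ * volume.real (F ∆ G)) := by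
  have eF := hF.toMeasurable_ae_eq
  have eG := hG.toMeasurable_ae_eq
  have vF : volume (toMeasurable volume F) < ∞ := by rwa [measure_toMeasurable]
  have vG : volume (toMeasurable volume G) < ∞ := by rwa [measure_toMeasurable]
  have mF := measurableSet_toMeasurable volume F
  have mG := measurableSet_toMeasurable volume G
  rw [setCurrent_congr_ae hF hF' eF.symm, setCurrent_congr_ae hG hG' eG.symm,
    setCurrent_sub mF.nullMeasurableSet vF mG.nullMeasurableSet vG,
    mass_topCurrent_indicator_sub mF mG vF vG, Measure.real, Measure.real,
    measure_congr (eF.symmDiff eG)]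

theorem mass_setCurrent_sub_lt_top {F G : Set (Space n)} (hF : NullMeasurableSet F)
    (hF' : volume F < ∞) (hG : NullMeasurableSet G) (hG' : volume G < ∞) :
    mass (setCurrent F - setCurrent G) < ∞ := by
  rw [mass_setCurrent_sub hF hF' hG hG']
  exact ENNReal.ofReal_lt_top

/-- `F` coincides with `E` outside an open set that is compactly contained in `U`. -/
def IsCompactVariation (E U F : Set (Space n)) : Prop :=
  ∃ U' : Set (Space n), IsOpen U' ∧ IsCompact (closure U') ∧ closure U' ⊆ U ∧ E \ U' = F \ U'

theorem IsCompactVariation.exists_isCompact {E U F G : Set (Space n)}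
    (hF : IsCompactVariation E U F) (hG : IsCompactVariation E U G) :
    ∃ K, IsCompact K ∧ K ⊆ U ∧ ∀ x ∉ K, x ∈ F ↔ x ∈ G := by
  obtain ⟨V, -, hVc, hVU, hV⟩ := hF
  obtain ⟨W, -, hWc, hWU, hW⟩ := hG
  refine ⟨closure V ∪ closure W, hVc.union hWc, Set.union_subset hVU hWU, fun x hx => ?_⟩
  have h1 : x ∉ V := fun h => hx (.inl (subset_closure h))
  have h2 : x ∉ W := fun h => hx (.inr (subset_closure h))
  have e1 : x ∈ E \ V ↔ x ∈ F \ V := by rw [hV]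
  have e2 : x ∈ E \ W ↔ x ∈ G \ W := by rw [hW]
  simp only [Set.mem_sdiff, h1, h2, not_false_eq_true, and_true] at e1 e2
  exact e1.symm.trans e2

theorem boundary_topCurrent_apply_eq_zero {θ : Space (p + 1) → ℝ} (hθ : Integrable θ)
    {K : Set (Space (p + 1))} (h : ∀ᵐ x, x ∉ K → θ x = 0) {ω : Form (p + 1) p}
    (hω : tsupport ω ⊆ Kᶜ) : boundary (topCurrent θ) ω = 0 := by
  rw [boundary_apply, topCurrent_apply hθ]
  refine integral_eq_zero_of_ae ?_
  filter_upwards [h] with x hx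
  by_cases hK : x ∈ K
  · have : extD (p + 1) p ω x = 0 := by
      by_contra h0
      exact hω (tsupport_extD_subset ω (subset_tsupport _ h0)) hK
    simp [this]
  · simp [hx hK]

/-- The difference is supported in a compact subset of `U`, where restriction to `U` changes
nothing. So `[[F]] - [[G]]` is a genuine filling of the difference of two members of the class. -/
theorem restrict_boundary_sub {U E F G : Set (Space (p + 1))} (hU : IsOpen U)
    (hF : IsFinitePerimeter F) (hG : IsFinitePerimeter G) (hFE : IsCompactVariation E U F)
    (hGE : IsCompactVariation E U G) :
    restrict (boundary (setCurrent F)) U - restrict (boundary (setCurrent G)) U =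
      boundary (setCurrent F - setCurrent G) := by
  obtain ⟨K, hK, hKU, hKe⟩ := hFE.exists_isCompact hGE
  rw [← restrict_sub hU hF.2.2 hG.2.2, ← boundary_sub]
  refine restrict_eq_self hU hK hKU ?_ fun ω hω => ?_
  · rw [boundary_sub]
    exact mass_sub_lt_top hF.2.2 hG.2.2
  · rw [setCurrent_sub hF.1 hF.2.1 hG.1 hG.2.1]
    refine boundary_topCurrent_apply_eq_zero ((integrable_indicator_one hF.1 hF.2.1).sub
      (integrable_indicator_one hG.1 hG.2.1)) (ae_of_all _ fun x hx => ?_) hω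
    change F.indicator (1 : Space (p + 1) → ℝ) x - G.indicator (1 : Space (p + 1) → ℝ) x = 0
    by_cases hxG : x ∈ G
    · simp [hxG, (hKe x hx).2 hxG]
    · simp [hxG, mt (hKe x hx).1 hxG]

theorem mass_zero : mass (0 : Current n k) = 0 := by
  simp [mass]

/-- If the infimum in the flat norm of `∂D` is attained at some filling, it is attained at `D`. -/
theorem flatNorm_boundary {lam : ℝ} (hlam : 0 < lam) {D R : Current (p + 1) (p + 1)}
    (hD : mass D < ∞) (hR : boundary R = boundary D)
    (h : flatNorm lam (boundary D) =
      mass (boundary D - boundary R) + ENNReal.ofReal lam * mass R) :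
    flatNorm lam (boundary D) = ENNReal.ofReal lam * mass D := by
  rw [hR, sub_self, mass_zero, zero_add] at h
  have hle : flatNorm lam (boundary D) ≤ ENNReal.ofReal lam * mass D := by
    refine (iInf_le _ D).trans ?_
    rw [sub_self, mass_zero, zero_add]
  have hl : ENNReal.ofReal lam ≠ 0 := by simpa using hlam
  -- Because `D` also competes and `lam` is positive, the optimal filling has finite mass, which
  -- uniqueness of fillings requires.
  have hRm : mass R < ∞ := by
    rw [h] at hle
    exact ((ENNReal.mul_le_mul_iff_right hl ENNReal.ofReal_ne_top).1 hle).trans_lt hD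
  have h0 : R - D = 0 := eq_zero_of_boundary_eq_zero (mass_sub_lt_top hRm hD) (by
    rw [boundary_sub, hR, sub_self])
  rw [h, sub_eq_zero.1 h0]

theorem measurableSet_box (a b : Fin n → ℝ) :
    MeasurableSet {z : Space n | ∀ i, a i ≤ z i ∧ z i < b i} := by
  simp only [Set.ofPred_forall]
  refine .iInter fun i => ?_
  have h : Measurable fun z : Space n => z i := by fun_prop
  exact (measurableSet_le measurable_const h).inter (measurableSet_lt h measurable_const)

theorem volume_box (a b : Fin n → ℝ) :
    volume {z : Space n | ∀ i, a i ≤ z i ∧ z i < b i} = ∏ i, ENNReal.ofReal (b i - a i) := by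
  have e : {z : Space n | ∀ i, a i ≤ z i ∧ z i < b i} =
      WithLp.ofLp ⁻¹' (Set.univ.pi fun i => Set.Ico (a i) (b i)) := by
    ext z
    simp
  rw [e, (PiLp.volume_preserving_ofLp (Fin n)).measure_preimage
    (MeasurableSet.univ_pi fun i => measurableSet_Ico).nullMeasurableSet, Real.volume_pi_Ico]

/-- The sharp factor is `√(p + 1)`; the cruder `p + 1` suffices and avoids roots in the later volume
estimates. -/
theorem mem_ball_of_forall_abs_lt {x z : Space (p + 1)} {r : ℝ} (hr : 0 < r)
    (h : ∀ i, |z i - x i| < r) : z ∈ Metric.ball x ((p + 1) * r) := by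
  rw [mem_ball_iff_norm, EuclideanSpace.norm_eq]
  refine (Real.sqrt_lt' (by positivity)).2 ?_
  have h1 : ∑ i, ‖(z - x) i‖ ^ 2 < ∑ _i : Fin (p + 1), r ^ 2 :=
    Finset.sum_lt_sum_of_nonempty Finset.univ_nonempty fun i _ =>
      pow_lt_pow_left₀ (h i) (abs_nonneg _) two_ne_zero
  refine h1.trans_le ?_
  simp only [Finset.sum_const, Finset.card_univ, Fintype.card_fin, nsmul_eq_mul]
  push_cast
  have : (0 : ℝ) ≤ p := by positivity
  nlinarith [mul_nonneg this (sq_nonneg r), mul_nonneg (mul_nonneg this this) (sq_nonneg r)]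

end

section

open scoped symmDiff

variable {n k p : ℕ}

/-! ### Competitors -/

/-- The current `[[G]] - [[F]]` has an integer density with rectifiable boundary in `U`. -/
theorem exists_hasRectifiableBoundary {U F G : Set (Space (p + 1))} (hU : IsOpen U)
    (hF : IsFinitePerimeter F) (hG : IsFinitePerimeter G)
    (hFr : IsRectifiable (restrict (boundary (setCurrent F)) U))
    (hGr : IsRectifiable (restrict (boundary (setCurrent G)) U)) :
    ∃ θ : Space (p + 1) → ℤ, HasRectifiableBoundary U θ ∧
      (fun x => (θ x : ℝ)) =ᵐ[volume] fun x => G.indicator 1 x - F.indicator 1 x := by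
  let Fm := toMeasurable volume F
  let Gm := toMeasurable volume G
  have eF : F.indicator (1 : Space (p + 1) → ℝ) =ᵐ[volume] Fm.indicator 1 :=
    indicator_ae_eq_of_ae_eq_set hF.1.toMeasurable_ae_eq.symm
  have eG : G.indicator (1 : Space (p + 1) → ℝ) =ᵐ[volume] Gm.indicator 1 :=
    indicator_ae_eq_of_ae_eq_set hG.1.toMeasurable_ae_eq.symm
  have e : (fun x => ((Gm.indicator 1 x - Fm.indicator 1 x : ℤ) : ℝ)) =ᵐ[volume]
      fun x => G.indicator 1 x - F.indicator 1 x := by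
    filter_upwards [eF, eG] with x h1 h2
    rw [h1, h2]
    by_cases a : x ∈ Fm <;> by_cases b : x ∈ Gm <;> simp [a, b]
  have hi : Integrable fun x => G.indicator 1 x - F.indicator (1 : Space (p + 1) → ℝ) x :=
    (integrable_indicator_one hG.1 hG.2.1).sub (integrable_indicator_one hF.1 hF.2.1)
  have hT : topCurrent (fun x => ((Gm.indicator 1 x - Fm.indicator 1 x : ℤ) : ℝ)) =
      setCurrent G - setCurrent F := by
    rw [setCurrent_sub hG.1 hG.2.1 hF.1 hF.2.1]
    exact (topCurrent_congr_ae hi e.symm).symm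
  refine ⟨fun x => Gm.indicator 1 x - Fm.indicator 1 x, ⟨?_, hi.congr e.symm, ?_, ?_⟩, e⟩
  · exact (measurable_one.indicator (measurableSet_toMeasurable _ _)).sub
      (measurable_one.indicator (measurableSet_toMeasurable _ _))
  · rw [hT, boundary_sub]
    exact mass_sub_lt_top hG.2.2 hF.2.2
  · rw [hT, boundary_sub, restrict_sub hU hG.2.2 hF.2.2]
    exact hGr.sub hFr

/-- Patching changes a current by a boundary, so `∂∂ = 0` makes the rectifiability of its own
boundary automatic. -/
theorem lowerBoundary_add_boundary {S : Current n k} {D : Current n (k + 1)} :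
    lowerBoundary (S + boundary D) = lowerBoundary S := by
  cases k with
  | zero => rfl
  | succ k =>
    change boundary (S + boundary D) = boundary S
    rw [boundary_add, boundary_boundary, add_zero]

/-- The indicator of the patched set is `1_F + 1_Q (1_G - 1_F)`. -/
theorem setCurrent_patch {F G Q : Set (Space n)} (hF : NullMeasurableSet F)
    (hF' : volume F < ∞) (hG : NullMeasurableSet G) (hG' : volume G < ∞) (hQ : MeasurableSet Q)
    {θ : Space n → ℤ} (hθ : (fun x => (θ x : ℝ)) =ᵐ[volume]
      fun x => G.indicator 1 x - F.indicator 1 x) :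
    setCurrent (F \ Q ∪ G ∩ Q) = setCurrent F +
      topCurrent (fun x => ((Q.indicator θ x : ℤ) : ℝ)) := by
  have hP : NullMeasurableSet (F \ Q ∪ G ∩ Q) :=
    (hF.diff hQ.nullMeasurableSet).union (hG.inter hQ.nullMeasurableSet)
  have hP' : volume (F \ Q ∪ G ∩ Q) < ∞ := (measure_union_le _ _).trans_lt
    (ENNReal.add_lt_top.2 ⟨(measure_mono Set.sdiff_subset).trans_lt hF',
      (measure_mono Set.inter_subset_left).trans_lt hG'⟩)
  rw [← sub_eq_iff_eq_add', setCurrent_sub hP hP' hF hF']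
  refine topCurrent_congr_ae ((integrable_indicator_one hP hP').sub
    (integrable_indicator_one hF hF')) ?_
  filter_upwards [hθ] with x hx
  by_cases hq : x ∈ Q
  · simp only [Set.indicator_of_mem hq, hx]
    by_cases hg : x ∈ G <;> simp [hq, hg]
  · by_cases hf : x ∈ F <;> simp [hq, hf]

/-- A box with generic faces is used because membership in the class demands integrality, and
slicing makes the faces contribute only rectifiable pieces. The box has sides longer than `r` and
lies in the ball of radius `(p + 1) r`, the two facts needed to compare its volume with the density
estimate. -/
theorem exists_competitor {U E F G : Set (Space (p + 1))} (hU : IsOpen U)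
    (hF : IsFinitePerimeter F) (hG : IsFinitePerimeter G) (hFE : IsCompactVariation E U F)
    (hFi : IsIntegral (restrict (boundary (setCurrent F)) U))
    (hGr : IsRectifiable (restrict (boundary (setCurrent G)) U)) (x : Space (p + 1)) {r : ℝ}
    (hr : 0 < r) (hx : Metric.closedBall x ((p + 1) * r) ⊆ U) :
    ∃ Q : Set (Space (p + 1)), MeasurableSet Q ∧ Q ⊆ Metric.ball x ((p + 1) * r) ∧
      ENNReal.ofReal (r ^ (p + 1)) ≤ volume Q ∧ IsFinitePerimeter (F \ Q ∪ G ∩ Q) ∧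
      IsCompactVariation E U (F \ Q ∪ G ∩ Q) ∧
      restrict (boundary (setCurrent (F \ Q ∪ G ∩ Q))) U ∈ currentClass E U := by
  obtain ⟨θ, hθ, hθe⟩ := exists_hasRectifiableBoundary hU hF hG hFi.1 hGr
  obtain ⟨a, b, hab, hθQ⟩ := hθ.exists_box hU x hr
  set Q := {z : Space (p + 1) | ∀ i, a i ≤ z i ∧ z i < b i}
  have hQ : MeasurableSet Q := measurableSet_box a b
  have hQb : Q ⊆ Metric.ball x ((p + 1) * r) := fun z hz =>
    mem_ball_of_forall_abs_lt hr fun i => abs_lt.2 ⟨by linarith [hz i, hab i],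
      by linarith [hz i, hab i]⟩
  have hQv : ENNReal.ofReal (r ^ (p + 1)) ≤ volume Q := by
    rw [volume_box, ENNReal.ofReal_pow hr.le, ← Fin.prod_const]
    refine Finset.prod_le_prod' fun i _ => ENNReal.ofReal_le_ofReal ?_
    linarith [hab i]
  have hP : NullMeasurableSet (F \ Q ∪ G ∩ Q) :=
    (hF.1.diff hQ.nullMeasurableSet).union (hG.1.inter hQ.nullMeasurableSet)
  have hP' : volume (F \ Q ∪ G ∩ Q) < ∞ := (measure_union_le _ _).trans_lt
    (ENNReal.add_lt_top.2 ⟨(measure_mono Set.sdiff_subset).trans_lt hF.2.1,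
      (measure_mono Set.inter_subset_left).trans_lt hG.2.1⟩)
  have hpatch := setCurrent_patch hF.1 hF.2.1 hG.1 hG.2.1 hQ hθe
  set D := topCurrent fun x => ((Q.indicator θ x : ℤ) : ℝ)
  have hPm : mass (boundary (setCurrent (F \ Q ∪ G ∩ Q))) < ∞ := by
    rw [hpatch, boundary_add]
    exact mass_add_lt_top hF.2.2 hθQ.mass_lt_top
  -- The correction lives in a closed ball contained in `U`.
  have hD : restrict (boundary D) U = boundary D :=
    restrict_eq_self hU (isCompact_closedBall x ((p + 1) * r)) hx hθQ.mass_lt_top fun ω hω =>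
      boundary_topCurrent_apply_eq_zero hθQ.integrable (ae_of_all _ fun z hz => by
        have : z ∉ Q := fun h => hz (Metric.ball_subset_closedBall (hQb h))
        simp [this]) hω
  have hr' : restrict (boundary (setCurrent (F \ Q ∪ G ∩ Q))) U =
      restrict (boundary (setCurrent F)) U + boundary D := by
    rw [← sub_eq_iff_eq_add', ← restrict_sub hU hPm hF.2.2, hpatch, boundary_add,
      add_sub_cancel_left, hD]
  have hvar : IsCompactVariation E U (F \ Q ∪ G ∩ Q) := by
    obtain ⟨V, hVo, hVc, hVU, hV⟩ := hFE
    refine ⟨V ∪ Metric.ball x ((p + 1) * r), hVo.union Metric.isOpen_ball, ?_, ?_, ?_⟩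
    · rw [closure_union]
      exact hVc.union ((isCompact_closedBall x _).of_isClosed_subset isClosed_closure
        Metric.closure_ball_subset_closedBall)
    · rw [closure_union]
      exact Set.union_subset hVU (Metric.closure_ball_subset_closedBall.trans hx)
    · rw [← Set.sdiff_sdiff, ← Set.sdiff_sdiff, hV]
      ext z
      have := @hQb z
      simp only [Set.mem_sdiff, Set.mem_union, Set.mem_inter_iff]
      tauto
  refine ⟨Q, hQ, hQb, hQv, ⟨hP, hP', hPm⟩, hvar, ⟨?_, ?_⟩, _, ⟨hP, hP', hPm⟩, rfl, hvar⟩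
  · rw [hr', ← hD]
    exact hFi.1.add hθQ.isRectifiable
  · rw [hr', lowerBoundary_add_boundary]
    exact hFi.2

/-! ### Density points -/

/-- At a density point the part of a small ball missed by `B` is less than half of `r ^ (p + 1)`.
Hence `B` fills more than half of every measurable subset of the ball with volume at least `r ^ (p +
1)`, in particular of the box of a competitor. -/
theorem exists_ball_of_volume_ne_zero {U B : Set (Space (p + 1))} (hU : IsOpen U)
    (hB : NullMeasurableSet B) (hv : volume B ≠ 0) (hBU : B ⊆ U) :
    ∃ (x : Space (p + 1)) (r : ℝ), 0 < r ∧ Metric.closedBall x ((p + 1) * r) ⊆ U ∧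
      volume.real (Metric.ball x ((p + 1) * r) \ B) < r ^ (p + 1) / 2 := by
  have hd := (ae_restrict_iff'₀ hB).1 (Besicovitch.ae_tendsto_measure_inter_div volume B)
  obtain ⟨x, hxB, hx⟩ : ∃ x ∈ B, Tendsto (fun r => volume (B ∩ Metric.closedBall x r) /
      volume (Metric.closedBall x r)) (𝓝[>] 0) (𝓝 1) := by
    by_contra! hc
    exact hv (measure_mono_null (fun x hx => by simpa using ⟨hx, hc x hx⟩) hd)
  set β := volume.real (Metric.ball (0 : Space (p + 1)) 1)
  have hβ : 0 ≤ β := measureReal_nonneg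
  have hp : (0 : ℝ) < (p : ℝ) + 1 := by positivity
  -- With `ρ = (p + 1) r` the ball has volume `ρ ^ (p + 1) * β`, and `ε` times this is `r ^ (p + 1)
  -- * β / (4 (β + 1))`, below `r ^ (p + 1) / 2`. Using `β + 1` keeps the denominator positive from
  -- `β ≥ 0` alone.
  set ε := 1 / (4 * (β + 1) * ((p : ℝ) + 1) ^ (p + 1))
  have hε : 0 < ε := by positivity
  have h1 := ((ENNReal.tendsto_toReal ENNReal.one_ne_top).comp hx).eventually
    (lt_mem_nhds (show 1 - ε < (1 : ℝ≥0∞).toReal by simpa using hε))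
  have h2 : ∀ᶠ ρ in 𝓝[>] (0 : ℝ), Metric.closedBall x ρ ⊆ U := by
    obtain ⟨δ, hδ, h⟩ := Metric.nhds_basis_closedBall.mem_iff.1 (hU.mem_nhds (hBU hxB))
    filter_upwards [Ioc_mem_nhdsGT hδ] with ρ hρ
    exact (Metric.closedBall_subset_closedBall hρ.2).trans h
  obtain ⟨ρ, hρ1, hρ2, hρ : 0 < ρ⟩ := (h1.and (h2.and self_mem_nhdsWithin)).exists
  have hρe : ((p : ℝ) + 1) * (ρ / (p + 1)) = ρ := by field_simp
  refine ⟨x, ρ / (p + 1), by positivity, by rwa [hρe], ?_⟩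
  rw [hρe]
  have hV : volume.real (Metric.closedBall x ρ) = ρ ^ (p + 1) * β := by
    rw [Measure.real, Measure.addHaar_closedBall _ _ hρ.le, ENNReal.toReal_mul,
      ENNReal.toReal_ofReal (by positivity)]
    simp [β, Measure.real]
  have hVpos : 0 < volume.real (Metric.closedBall x ρ) :=
    ENNReal.toReal_pos (Metric.measure_closedBall_pos _ _ hρ).ne' measure_closedBall_lt_top.ne
  have h3 : 1 - ε < volume.real (B ∩ Metric.closedBall x ρ) /
      volume.real (Metric.closedBall x ρ) := by
    simpa [ENNReal.toReal_div, Measure.real] using hρ1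
  rw [lt_div_iff₀ hVpos] at h3
  have h4 := measureReal_inter_add_sdiff₀ (μ := volume) (s := Metric.closedBall x ρ) hB
    measure_closedBall_lt_top.ne
  rw [Set.inter_comm] at h4
  have h5 : volume.real (Metric.ball x ρ \ B) ≤ volume.real (Metric.closedBall x ρ \ B) :=
    measureReal_mono (Set.sdiff_subset_sdiff_left Metric.ball_subset_closedBall)
      ((measure_mono Set.sdiff_subset).trans_lt measure_closedBall_lt_top).ne
  have h6 : ε * volume.real (Metric.closedBall x ρ) < (ρ / (p + 1)) ^ (p + 1) / 2 := by
    rw [hV, div_pow]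
    have e : ε * (ρ ^ (p + 1) * β) = ρ ^ (p + 1) / ((p : ℝ) + 1) ^ (p + 1) *
        (β / (4 * (β + 1))) := by
      simp only [ε]
      field_simp
    rw [e, div_eq_mul_inv _ (2 : ℝ)]
    refine mul_lt_mul_of_pos_left ?_ (by positivity)
    rw [div_lt_iff₀ (by positivity)]
    linarith
  linarith

/-- On `Q ∩ B` the set `F` disagrees with `H` and the patch agrees with it, so that volume is
gained; on `Q \ B` the worst case is complete disagreement. -/
theorem measureReal_patch_lt {F G H Q B : Set (Space n)} (hF : volume F ≠ ∞)
    (hH : volume H ≠ ∞) (hQ : MeasurableSet Q) (hQ' : volume Q ≠ ∞) (hBF : B ⊆ F ∆ G)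
    (hBH : ∀ x ∈ B, x ∈ G ↔ x ∈ H) (h : volume.real (Q \ B) < volume.real (Q ∩ B)) :
    volume.real ((F \ Q ∪ G ∩ Q) ∆ H) < volume.real (F ∆ H) := by
  have hFH : volume (F ∆ H) ≠ ∞ := ((measure_mono (show F ∆ H ⊆ F ∪ H from
    Set.symmDiff_subset_union)).trans (measure_union_le _ _)).trans_lt
      (ENNReal.add_lt_top.2 ⟨hF.lt_top, hH.lt_top⟩) |>.ne
  have s1 : (F \ Q ∪ G ∩ Q) ∆ H ⊆ (F ∆ H) \ Q ∪ Q \ B := fun x hx => by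
    have := hBH x
    simp only [Set.mem_symmDiff, Set.mem_sdiff, Set.mem_union, Set.mem_inter_iff] at hx ⊢
    tauto
  have s2 : Q ∩ B ⊆ (F ∆ H) ∩ Q := fun x hx => by
    have h1 := hBH x hx.2
    have h2 := hBF hx.2
    have h3 := hx.1
    simp only [Set.mem_symmDiff, Set.mem_inter_iff] at h2 ⊢
    tauto
  have a1 : volume ((F ∆ H) \ Q) ≠ ∞ := ne_top_of_le_ne_top hFH (measure_mono Set.sdiff_subset)
  have a2 : volume (Q \ B) ≠ ∞ := ne_top_of_le_ne_top hQ' (measure_mono Set.sdiff_subset)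
  have a3 : volume ((F ∆ H) ∩ Q) ≠ ∞ :=
    ne_top_of_le_ne_top hFH (measure_mono Set.inter_subset_left)
  calc volume.real ((F \ Q ∪ G ∩ Q) ∆ H)
      ≤ volume.real ((F ∆ H) \ Q ∪ Q \ B) := measureReal_mono s1
        ((measure_union_le _ _).trans_lt (ENNReal.add_lt_top.2 ⟨a1.lt_top, a2.lt_top⟩)).ne
    _ ≤ volume.real ((F ∆ H) \ Q) + volume.real (Q \ B) := measureReal_union_le _ _
    _ < volume.real ((F ∆ H) \ Q) + volume.real (Q ∩ B) := by linarith
    _ ≤ volume.real ((F ∆ H) \ Q) + volume.real ((F ∆ H) ∩ Q) := by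
        linarith [measureReal_mono s2 a3]
    _ = volume.real (F ∆ H) := measureReal_sdiff_add_inter hQ hFH

end

section

open scoped symmDiff

variable {n k p : ℕ}

/-! ### The envelope -/

theorem ae_mem_preciseRep {A : Set (Space (p + 1))} (hA : NullMeasurableSet A) :
    ∀ᵐ x, x ∈ A → x ∈ preciseRep A := by
  filter_upwards [(ae_restrict_iff'₀ hA).1 (Besicovitch.ae_tendsto_measure_inter_div volume A)]
    with x hx hxA
  refine (hx hxA).congr fun r => ?_
  -- The density theorem uses closed balls and the precise representative open ones; spheres are
  -- null.
  have h : Metric.ball x r =ᵐ[volume] Metric.closedBall x r :=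
    ae_eq_of_subset_of_measure_ge Metric.ball_subset_closedBall
      (Measure.addHaar_closedBall_eq_addHaar_ball volume x r).le
      measurableSet_ball.nullMeasurableSet measure_closedBall_lt_top.ne
  rw [measure_congr h, measure_congr ((ae_eq_refl A).inter h)]

theorem volume_symmDiff_lt_top {F G : Set (Space n)} (hF : volume F < ∞) (hG : volume G < ∞) :
    volume (F ∆ G) < ∞ :=
  ((measure_mono Set.symmDiff_subset_union).trans (measure_union_le F G)).trans_lt
    (ENNReal.add_lt_top.2 ⟨hF, hG⟩)

/-- The symmetric difference, with multiplicity `1` on `Fᵢ` and `-1` off it, is an admissible region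
between the two currents, and almost all of its points are density points. -/
theorem ae_mem_envelope {N : ℕ} {T : Fin N → Current (p + 1) p}
    {F : Fin N → Set (Space (p + 1))} (hF : ∀ i, IsFinitePerimeter (F i))
    (hT : ∀ i j, T i - T j = boundary (setCurrent (F i) - setCurrent (F j))) :
    ∀ᵐ x, ∀ i j, x ∈ F i ∆ F j → x ∈ envelope T := by
  have key : ∀ i j, i < j → ∀ᵐ x, x ∈ F i ∆ F j → x ∈ envelope T := by
    intro i j hij
    have hA : NullMeasurableSet (F i ∆ F j) := (hF i).1.symmDiff (hF j).1
    filter_upwards [ae_mem_preciseRep hA] with x hx hxA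
    -- The measurable hull makes the multiplicity `2 · 1_P - 1` measurable; it takes only the values
    -- `±1`.
    let P := toMeasurable volume (F i)
    have hP : P =ᵐ[volume] F i := (hF i).1.toMeasurable_ae_eq
    refine ⟨i, j, hij, F i ∆ F j, P.indicator 2 - 1, hA,
      volume_symmDiff_lt_top (hF i).2.1 (hF j).2.1, ?_, fun y _ => ?_, ?_, hx hxA⟩
    · exact (measurable_const.indicator (measurableSet_toMeasurable _ _)).sub measurable_one
    · by_cases hy : y ∈ P <;> simp [hy]
    · rw [hT, setCurrent_sub (hF i).1 (hF i).2.1 (hF j).1 (hF j).2.1, multCurrent]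
      congr 1
      refine (topCurrent_congr_ae ((integrable_indicator_one (hF i).1 (hF i).2.1).sub
        (integrable_indicator_one (hF j).1 (hF j).2.1)) ?_).symm
      filter_upwards [hP.mem_iff] with y hy
      by_cases h1 : y ∈ F i <;> by_cases h2 : y ∈ F j <;>
        simp [h1, h2, hy, Set.indicator, Set.mem_symmDiff]
  refine ae_all_iff.2 fun i => ae_all_iff.2 fun j => ?_
  rcases lt_trichotomy i j with h | h | h
  · exact key i j h
  · simp [h]
  · rw [symmDiff_comm]
    exact key j i h

/-! ### Medians -/

/-- A set that minimizes the sum of the volumes of the differences to the `Fᵢ`, among the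
competitors that copy one of the `Fᵢ` in a small ball, agrees with each `Fᵢ` away from the
differences of the `Fᵢ`. -/
theorem ae_mem_symmDiff {N : ℕ} {U F : Set (Space (p + 1))} (hU : IsOpen U)
    {G : Fin N → Set (Space (p + 1))} (hF : NullMeasurableSet F) (hF' : volume F < ∞)
    (hG : ∀ i, NullMeasurableSet (G i)) (hG' : ∀ i, volume (G i) < ∞) (i₀ : Fin N)
    (hFU : F ∆ G i₀ ⊆ U)
    (hmin : ∀ (x : Space (p + 1)) (r : ℝ), 0 < r → Metric.closedBall x ((p + 1) * r) ⊆ U →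
      ∃ Q : Set (Space (p + 1)), MeasurableSet Q ∧ Q ⊆ Metric.ball x ((p + 1) * r) ∧
        ENNReal.ofReal (r ^ (p + 1)) ≤ volume Q ∧
        ∑ i, volume.real (F ∆ G i) ≤ ∑ i, volume.real ((F \ Q ∪ G i₀ ∩ Q) ∆ G i)) :
    ∀ᵐ x, x ∈ F ∆ G i₀ → ∃ i j, x ∈ G i ∆ G j := by
  -- On `B` all the `G i` agree with one another and `F` disagrees with all of them.
  set B := (F ∆ G i₀) \ ⋃ i, ⋃ j, G i ∆ G j 
  have hB : NullMeasurableSet B := (hF.symmDiff (hG i₀)).diff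
    (.iUnion fun i => .iUnion fun j => (hG i).symmDiff (hG j))
  suffices hv : volume B = 0 by
    filter_upwards [measure_eq_zero_iff_ae_notMem.1 hv] with x hx hxF
    by_contra hc
    exact hx ⟨hxF, by simpa using hc⟩
  by_contra hv
  obtain ⟨x, r, hr, hxU, hx⟩ := exists_ball_of_volume_ne_zero hU hB hv
    (Set.sdiff_subset.trans hFU)
  obtain ⟨Q, hQ, hQb, hQv, hsum⟩ := hmin x r hr hxU
  -- Copying `G i₀` inside `Q` strictly lowers every summand, not only the one of index `i₀`, since
  -- all the `G i` agree on `B`.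
  refine hsum.not_gt (Finset.sum_lt_sum_of_nonempty ⟨i₀, Finset.mem_univ _⟩ fun i _ => ?_)
  have hQ' : volume Q ≠ ∞ := ((measure_mono hQb).trans_lt measure_ball_lt_top).ne
  refine measureReal_patch_lt (B := B) hF'.ne (hG' i).ne hQ hQ' Set.sdiff_subset (fun y hy => ?_) ?_
  · have : y ∉ G i₀ ∆ G i := fun h => hy.2 (Set.mem_iUnion₂.2 ⟨i₀, i, h⟩)
    rw [Set.mem_symmDiff] at this
    tauto
  · have h1 : r ^ (p + 1) ≤ volume.real Q :=
      (ENNReal.ofReal_le_iff_le_toReal hQ').1 hQv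
    have h2 : volume.real (Q \ B) ≤ volume.real (Metric.ball x ((p + 1) * r) \ B) :=
      measureReal_mono (Set.sdiff_subset_sdiff_left hQb)
        ((measure_mono Set.sdiff_subset).trans_lt measure_ball_lt_top).ne
    have h3 := measureReal_inter_add_sdiff₀ (μ := volume) (s := Q) hB hQ'
    linarith

/-- Turns the flat distance into a volume: the filling is forced to be `[[F]] - [[G]]`, and its mass
is known. The factor does not depend on the sets, so it cancels in the comparison of competitors. -/
theorem flatNorm_sub {N : ℕ} {E U F G : Set (Space (p + 1))} (hU : IsOpen U)
    {T : Fin N → Current (p + 1) p} {lam : ℝ} (hlam : 0 < lam)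
    (hsmall : IsFillingScale (currentClass E U) T lam) (i : Fin N)
    (hF : IsFinitePerimeter F) (hG : IsFinitePerimeter G) (hFE : IsCompactVariation E U F)
    (hGE : IsCompactVariation E U G) (hT : T i = restrict (boundary (setCurrent G)) U)
    (hFc : restrict (boundary (setCurrent F)) U ∈ currentClass E U) :
    flatNorm lam (restrict (boundary (setCurrent F)) U - T i) =
      ENNReal.ofReal (lam * ‖volForm (p + 1)‖⁻¹ * volume.real (F ∆ G)) := by
  obtain ⟨R, hR, hR'⟩ := hsmall _ hFc i
  rw [hT, restrict_boundary_sub hU hF hG hFE hGE] at hR hR' ⊢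
  rw [flatNorm_boundary hlam (mass_setCurrent_sub_lt_top hF.1 hF.2.1 hG.1 hG.2.1) hR hR',
    mass_setCurrent_sub hF.1 hF.2.1 hG.1 hG.2.1, ← ENNReal.ofReal_mul hlam.le, mul_assoc]

end

end FlatMedian

end

/-! ### The theorem on medians and envelopes -/

theorem mainTheorem3 (p N : ℕ) (E U : Set (FlatMedian.Space (p + 1)))
    (hE : FlatMedian.IsFinitePerimeter E) (hUo : IsOpen U) (hUb : Bornology.IsBounded U)
    (hEU : FlatMedian.mass (FlatMedian.lowerBoundary
      (FlatMedian.restrict (FlatMedian.boundary (FlatMedian.setCurrent E)) U)) < ⊤)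
    (T : Fin N → FlatMedian.Current (p + 1) p)
    (hT : ∀ i, T i ∈ FlatMedian.currentClass E U)
    (lam : ℝ) (hlam : 0 < lam)
    (hsmall : FlatMedian.IsFillingScale (FlatMedian.currentClass E U) T lam)
    (S : FlatMedian.Current (p + 1) p)
    (hS : FlatMedian.IsMedian (FlatMedian.currentClass E U) T lam S) :
    ∀ i, FlatMedian.supp (S - T i) ⊆ closure (FlatMedian.envelope T) ∧
      FlatMedian.restrict S (closure (FlatMedian.envelope T))ᶜ =
        FlatMedian.restrict (T i) (closure (FlatMedian.envelope T))ᶜ := by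
  intro i
  obtain ⟨hSc, hSmin⟩ := hS
  obtain ⟨hFi, F, hF, rfl, hFE⟩ := hSc
  choose hTi G hG hTG hGE using hT
  have hT : ∀ i j, T i - T j = FlatMedian.boundary
      (FlatMedian.setCurrent (G i) - FlatMedian.setCurrent (G j)) := fun i j => by
    rw [hTG i, hTG j]
    exact FlatMedian.restrict_boundary_sub hUo (hG i) (hG j) (hGE i) (hGE j)
  set C := closure (FlatMedian.envelope T)
  -- The geometric core: almost every point at which `F` and `G i` differ is one at which two of the
  -- `G j` differ, hence lies in the envelope.
  have hFC : ∀ᵐ x, x ∈ symmDiff F (G i) → x ∈ C := by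
    have h1 := FlatMedian.ae_mem_symmDiff hUo hF.1 hF.2.1 (fun i => (hG i).1)
      (fun i => (hG i).2.1) i ?_ ?_
    · filter_upwards [h1, FlatMedian.ae_mem_envelope hG hT] with x hx hx' hxF
      obtain ⟨j, k, hjk⟩ := hx hxF
      exact subset_closure (hx' j k hjk)
    · obtain ⟨K, -, hKU, hK⟩ := FlatMedian.IsCompactVariation.exists_isCompact hFE (hGE i)
      intro x hx
      by_contra hxU
      have := hK x fun h => hxU (hKU h)
      rw [Set.mem_symmDiff] at hx
      tauto
    · intro x r hr hx
      obtain ⟨Q, hQ, hQb, hQv, hP, hPE, hPc⟩ := FlatMedian.exists_competitor hUo hF (hG i) hFE hFi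
        (hTG i ▸ (hTi i).1) x hr hx
      refine ⟨Q, hQ, hQb, hQv, ?_⟩
      have hFc : FlatMedian.restrict (FlatMedian.boundary (FlatMedian.setCurrent F)) U ∈
          FlatMedian.currentClass E U := ⟨hFi, F, hF, rfl, hFE⟩
      have hle := hSmin _ hPc
      have hc : 0 < lam * ‖FlatMedian.volForm (p + 1)‖⁻¹ :=
        mul_pos hlam (inv_pos.2 FlatMedian.norm_volForm_pos)
      -- Both sums of flat distances become the same positive constant times sums of volumes, which
      -- leaves a comparison of volumes.
      rw [Finset.sum_congr rfl fun j _ => FlatMedian.flatNorm_sub hUo hlam hsmall j hF (hG j) hFE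
          (hGE j) (hTG j) hFc,
        Finset.sum_congr rfl fun j _ => FlatMedian.flatNorm_sub hUo hlam hsmall j hP (hG j) hPE
          (hGE j) (hTG j) hPc,
        ← ENNReal.ofReal_sum_of_nonneg fun j _ => mul_nonneg hc.le MeasureTheory.measureReal_nonneg,
        ← ENNReal.ofReal_sum_of_nonneg fun j _ => mul_nonneg hc.le MeasureTheory.measureReal_nonneg,
        ENNReal.ofReal_le_ofReal_iff (Finset.sum_nonneg fun j _ =>
          mul_nonneg hc.le MeasureTheory.measureReal_nonneg), ← Finset.mul_sum,
        ← Finset.mul_sum] at hle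
      exact le_of_mul_le_mul_left hle hc
  -- Both conclusions follow from this vanishing: the difference is the boundary of a density that
  -- is zero almost everywhere off `C`.
  have hvan : ∀ ω : FlatMedian.Form (p + 1) p, tsupport ω ⊆ Cᶜ →
      (FlatMedian.restrict (FlatMedian.boundary (FlatMedian.setCurrent F)) U - T i) ω = 0 := by
    intro ω hω
    rw [hTG i, FlatMedian.restrict_boundary_sub hUo hF (hG i) hFE (hGE i),
      FlatMedian.setCurrent_sub hF.1 hF.2.1 (hG i).1 (hG i).2.1]
    refine FlatMedian.boundary_topCurrent_apply_eq_zero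
      ((FlatMedian.integrable_indicator_one hF.1 hF.2.1).sub
        (FlatMedian.integrable_indicator_one (hG i).1 (hG i).2.1)) ?_ hω
    filter_upwards [hFC] with x hx hxC
    have h := fun h => hxC (hx h)
    rw [Set.mem_symmDiff] at h
    by_cases h1 : x ∈ F <;> by_cases h2 : x ∈ G i <;> simp_all
  refine ⟨fun x hx => (Distribution.mem_dsupport_iff x).1 hx C hvan isClosed_closure, ?_⟩
  refine FlatMedian.restrict_congr isClosed_closure.isOpen_compl
    (FlatMedian.mass_restrict_lt_top hUo hF.2.2) ?_ fun ω hω => sub_eq_zero.1 (hvan ω hω)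
  rw [hTG i]
  exact FlatMedian.mass_restrict_lt_top hUo (hG i).2.2
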